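/- Let $n,p\ge 0$ be integers and let $V=\mathrm{Hom}(\mathbb C^n,\mathbb C^p)\oplus\mathrm{Hom}(\mathbb C^p,\mathbb C^n)$, on which $g\in\mathrm{GL}_n=\mathrm{GL}(\mathbb C^n)$ acts by $g\cdot(L\oplus\tilde L)=Lg^{-1}\oplus g\tilde L$. For a subgroup $G\subset\mathrm{GL}_n$ let $\mathcal O(V)^G$ be the algebra of $G$-invariant holomorphic functions $V\to\mathbb C$, and for a finite-dimensional complex vector space $W$ let $\mathcal O(W)$ be the algebra of holomorphic functions $W\to\mathbb C$. Put $U=\mathbb C^p\oplus(\mathbb C^p)^*$, with the bilinear forms $s(v\oplus\varphi,v'\oplus\varphi')=\varphi'(v)+\varphi(v')$ and $a(v\oplus\varphi,v'\oplus\varphi')=\varphi'(v)-\varphi(v')$, and for $b\in\{s,a\}$ let $\mathrm{Sym}_b(U)=\{w\in\mathrm{End}(U): b(wx,y)=b(x,wy)\ \text{for all } x,y\in U\}$. Consider the following three cases of a group $G$, a complex vector space $W$ and a $G$-invariant quadratic map $Q:V\to W$. (i) $G=\mathrm{GL}_n$, $W=\mathrm{End}(\mathbb C^p)$, $Q(L\oplus\tilde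 L)=L\tilde L$. (ii) $G=\mathrm{O}_n=\{g\in\mathrm{GL}_n: g^{\mathrm t}\beta g=\beta\}$, where $\beta:\mathbb C^n\to(\mathbb C^n)^*$ is any symmetric linear isomorphism ($\beta^{\mathrm t}=\beta$), $W=\mathrm{Sym}_s(U)$, and $$Q(L\oplus\tilde L)=\begin{pmatrix} L\tilde L & L\beta^{-1}L^{\mathrm t}\\ \tilde L^{\mathrm t}\beta\tilde L & \tilde L^{\mathrm t}L^{\mathrm t}\end{pmatrix}.$$ (iii) $G=\mathrm{Sp}_n=\{g\in\mathrm{GL}_n: g^{\mathrm t}\beta g=\beta\}$, where $\beta:\mathbb C^n\to(\mathbb C^n)^*$ is any alternating linear isomorphism ($\beta^{\mathrm t}=-\beta$, so that $n$ is even), $W=\mathrm{Sym}_a(U)$, and $Q$ is given by the same formula as in (ii). Then in each of the three cases $Q$ maps into $W$ and is $G$-invariant, and the algebra homomorphism $Q^*:\mathcal O(W)\to\mathcal O(V)^G$, $F\mapsto F\circ Q$, is surjective. -/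

import Mathlib

open Matrix
open scoped Matrix.Norms.Elementwise

/-- The algebra `𝒪(E)` of holomorphic (that is, everywhere complex differentiable) functions on a
complex normed space `E`. -/
def Hol (E : Type) [NormedAddCommGroup E] [NormedSpace ℂ E] : Subalgebra ℂ (E → ℂ) where
  carrier := {f | Differentiable ℂ f}
  mul_mem' hf hg := Differentiable.mul hf hg
  add_mem' hf hg := Differentiable.add hf hg
  algebraMap_mem' c := differentiable_const c

/-- `V = Hom(ℂⁿ, ℂᵖ) ⊕ Hom(ℂᵖ, ℂⁿ)`, a linear map being identified with its matrix in the standard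
bases.  An element is a pair `(L, L̃)`. -/
abbrev VSpace (n p : ℕ) : Type := Matrix (Fin p) (Fin n) ℂ × Matrix (Fin n) (Fin p) ℂ

/-- The action `g . (L ⊕ L̃) = L g⁻¹ ⊕ g L̃` of `GL_n` on `V`. -/
def gact {n p : ℕ} (g : GL (Fin n) ℂ) (v : VSpace n p) : VSpace n p :=
  (v.1 * (↑g⁻¹ : Matrix (Fin n) (Fin n) ℂ), (g : Matrix (Fin n) (Fin n) ℂ) * v.2)

/-- The algebra `𝒪(V)^G` of `G`-invariant holomorphic functions on `V`. -/
def HolInv {n : ℕ} (G : Subgroup (GL (Fin n) ℂ)) (p : ℕ) : Subalgebra ℂ (VSpace n p → ℂ) where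
  carrier := {f | f ∈ Hol (VSpace n p) ∧ ∀ g ∈ G, ∀ v, f (gact g v) = f v}
  mul_mem' := by
    rintro a b ⟨ha, ha'⟩ ⟨hb, hb'⟩
    exact ⟨mul_mem ha hb, fun g hg v => by simp [ha' g hg v, hb' g hg v]⟩
  add_mem' := by
    rintro a b ⟨ha, ha'⟩ ⟨hb, hb'⟩
    exact ⟨add_mem ha hb, fun g hg v => by simp [ha' g hg v, hb' g hg v]⟩
  algebraMap_mem' c := ⟨(Hol (VSpace n p)).algebraMap_mem c, fun _ _ _ => rfl⟩

/-- The pullback homomorphism `F ↦ F ∘ q`, `𝒪(W) → 𝒪(V)^G`, along a `G`-invariant holomorphic map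
`q : V → W`. -/
noncomputable def pullback {n p : ℕ} (G : Subgroup (GL (Fin n) ℂ)) {W : Type} [NormedAddCommGroup W]
    [NormedSpace ℂ W] (q : VSpace n p → W) (hq : Differentiable ℂ q)
    (hinv : ∀ g ∈ G, ∀ v, q (gact g v) = q v) : Hol W →ₐ[ℂ] HolInv G p where
  toFun F := ⟨fun v => (F : W → ℂ) (q v),
    Differentiable.comp F.2 hq, fun g hg v => by simp only [hinv g hg v]⟩
  map_one' := rfl
  map_mul' _ _ := rfl
  map_zero' := rfl
  map_add' _ _ := rfl
  commutes' _ := rfl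

/-- The isometry group `{g ∈ GL_n | gᵗ β g = β}` of the bilinear form with Gram matrix `β`: it is
`O_n` for `β` symmetric and `Sp_n` for `β` alternating (`β` non-degenerate). -/
def isomGroup {n : ℕ} (β : Matrix (Fin n) (Fin n) ℂ) : Subgroup (GL (Fin n) ℂ) where
  carrier := {g | (g : Matrix (Fin n) (Fin n) ℂ)ᵀ * β * (g : Matrix (Fin n) (Fin n) ℂ) = β}
  one_mem' := by simp
  mul_mem' := by
    intro a b ha hb
    simp only [Set.mem_ofPred_eq, Units.val_mul, transpose_mul] at *
    calc _ = (b : Matrix (Fin n) (Fin n) ℂ)ᵀ *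
          ((a : Matrix (Fin n) (Fin n) ℂ)ᵀ * β * (a : Matrix (Fin n) (Fin n) ℂ)) *
          (b : Matrix (Fin n) (Fin n) ℂ) := by simp only [Matrix.mul_assoc]
      _ = β := by rw [ha, hb]
  inv_mem' := by
    intro a ha
    simp only [Set.mem_ofPred_eq] at *
    have h1 : (a : Matrix (Fin n) (Fin n) ℂ) * (↑a⁻¹ : Matrix (Fin n) (Fin n) ℂ) = 1 :=
      Units.mul_inv a
    have h2 : (↑a⁻¹ : Matrix (Fin n) (Fin n) ℂ)ᵀ * (a : Matrix (Fin n) (Fin n) ℂ)ᵀ = 1 := by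
      rw [← transpose_mul, h1, transpose_one]
    calc _ = (↑a⁻¹ : Matrix (Fin n) (Fin n) ℂ)ᵀ *
          ((a : Matrix (Fin n) (Fin n) ℂ)ᵀ * β * (a : Matrix (Fin n) (Fin n) ℂ)) *
          (↑a⁻¹ : Matrix (Fin n) (Fin n) ℂ) := by rw [ha]
      _ = ((↑a⁻¹ : Matrix (Fin n) (Fin n) ℂ)ᵀ * (a : Matrix (Fin n) (Fin n) ℂ)ᵀ) * β *
          ((a : Matrix (Fin n) (Fin n) ℂ) * (↑a⁻¹ : Matrix (Fin n) (Fin n) ℂ)) := by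
          simp only [Matrix.mul_assoc]
      _ = β := by rw [h1, h2, Matrix.one_mul, Matrix.mul_one]

/-- Gram matrix of the symmetric form `s(v ⊕ φ, v' ⊕ φ') = φ'(v) + φ(v')` on `U = ℂᵖ ⊕ (ℂᵖ)*`, in
the standard basis of `ℂᵖ` followed by its dual basis. -/
def formS (p : ℕ) : Matrix (Fin p ⊕ Fin p) (Fin p ⊕ Fin p) ℂ := fromBlocks 0 1 1 0

/-- Gram matrix of the alternating form `a(v ⊕ φ, v' ⊕ φ') = φ'(v) - φ(v')` on
`U = ℂᵖ ⊕ (ℂᵖ)*`. -/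
def formA (p : ℕ) : Matrix (Fin p ⊕ Fin p) (Fin p ⊕ Fin p) ℂ := fromBlocks 0 1 (-1) 0

/-- `Sym_b(U)`: the endomorphisms `L` of `U` with `b(L x, y) = b(x, L y)` for all `x`, `y`, where
`b(x, y) = xᵗ J y`. -/
def SymB {p : ℕ} (J : Matrix (Fin p ⊕ Fin p) (Fin p ⊕ Fin p) ℂ) :
    Submodule ℂ (Matrix (Fin p ⊕ Fin p) (Fin p ⊕ Fin p) ℂ) where
  carrier := {L | ∀ x y : Fin p ⊕ Fin p → ℂ, (L *ᵥ x) ⬝ᵥ (J *ᵥ y) = x ⬝ᵥ (J *ᵥ (L *ᵥ y))}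
  zero_mem' := by intro x y; simp
  add_mem' := by
    intro a b ha hb x y
    simp only [add_mulVec, add_dotProduct, mulVec_add, dotProduct_add, ha x y, hb x y]
  smul_mem' := by
    intro c a ha x y
    simp only [smul_mulVec, smul_dotProduct, mulVec_smul, dotProduct_smul, ha x y]

theorem mem_SymB_iff {p : ℕ} (J L : Matrix (Fin p ⊕ Fin p) (Fin p ⊕ Fin p) ℂ) :
    L ∈ SymB J ↔ Lᵀ * J = J * L := by
  have key : ∀ x y : Fin p ⊕ Fin p → ℂ,
      (L *ᵥ x) ⬝ᵥ (J *ᵥ y) = x ⬝ᵥ ((Lᵀ * J) *ᵥ y) := by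
    intro x y
    rw [← vecMul_transpose, ← dotProduct_mulVec, mulVec_mulVec]
  constructor
  · intro h
    refine Matrix.ext fun i j => ?_
    have := h (Pi.single i 1) (Pi.single j 1)
    rw [key, mulVec_mulVec] at this
    simpa using this
  · intro h x y
    rw [key, mulVec_mulVec, h]

/-- The quadratic map `Q : V → W = End(ℂᵖ)`, `L ⊕ L̃ ↦ L L̃`, for `G = GL_n`. -/
def QGL {n p : ℕ} (v : VSpace n p) : Matrix (Fin p) (Fin p) ℂ := v.1 * v.2

/-- The quadratic map `Q : V → End(U)` for `G = O_n, Sp_n`, with blocks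
`(L L̃, L β⁻¹ Lᵗ; L̃ᵗ β L̃, L̃ᵗ Lᵗ)`. -/
noncomputable def QMat {n p : ℕ} (β : Matrix (Fin n) (Fin n) ℂ) (v : VSpace n p) :
    Matrix (Fin p ⊕ Fin p) (Fin p ⊕ Fin p) ℂ :=
  fromBlocks (v.1 * v.2) (v.1 * β⁻¹ * v.1ᵀ) (v.2ᵀ * β * v.2) (v.2ᵀ * v.1ᵀ)

theorem differentiable_matrix_iff {E : Type} [NormedAddCommGroup E] [NormedSpace ℂ E]
    {m k : Type} [Fintype m] [Fintype k] {f : E → Matrix m k ℂ} :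
    Differentiable ℂ f ↔ ∀ i j, Differentiable ℂ (fun x => f x i j) := by
  constructor
  · intro h i j
    exact differentiable_pi.1 (differentiable_pi.1 h i) j
  · intro h
    exact differentiable_pi.2 fun i => differentiable_pi.2 fun j => h i j

theorem differentiable_matrix_mul {E : Type} [NormedAddCommGroup E] [NormedSpace ℂ E]
    {m k l : Type} [Fintype m] [Fintype k] [Fintype l]
    {f : E → Matrix m k ℂ} {g : E → Matrix k l ℂ}
    (hf : Differentiable ℂ f) (hg : Differentiable ℂ g) :
    Differentiable ℂ (fun x => f x * g x) := by
  rw [differentiable_matrix_iff] at *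
  intro i j
  simp only [Matrix.mul_apply]
  exact Differentiable.fun_sum fun c _ => (hf i c).mul (hg c j)

theorem differentiable_matrix_transpose {E : Type} [NormedAddCommGroup E] [NormedSpace ℂ E]
    {m k : Type} [Fintype m] [Fintype k] {f : E → Matrix m k ℂ} (hf : Differentiable ℂ f) :
    Differentiable ℂ (fun x => (f x)ᵀ) := by
  rw [differentiable_matrix_iff] at *
  exact fun i j => hf j i

theorem QGL_differentiable {n p : ℕ} : Differentiable ℂ (QGL (n := n) (p := p)) :=
  differentiable_matrix_mul differentiable_fst differentiable_snd

theorem gact_mul {n p : ℕ} (g : GL (Fin n) ℂ) (v : VSpace n p) :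
    (gact g v).1 * (gact g v).2 = v.1 * v.2 := by
  have h1 : (↑g⁻¹ : Matrix (Fin n) (Fin n) ℂ) * (g : Matrix (Fin n) (Fin n) ℂ) = 1 :=
    Units.inv_mul g
  calc _ = v.1 * ((↑g⁻¹ : Matrix (Fin n) (Fin n) ℂ) * (g : Matrix (Fin n) (Fin n) ℂ)) * v.2 := by
        simp only [gact, Matrix.mul_assoc]
    _ = _ := by rw [h1, Matrix.mul_one]

theorem QMat_differentiable {n p : ℕ} (β : Matrix (Fin n) (Fin n) ℂ) :
    Differentiable ℂ (QMat (p := p) β) := by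
  have h1 : Differentiable ℂ (fun v : VSpace n p => v.1) := differentiable_fst
  have h2 : Differentiable ℂ (fun v : VSpace n p => v.2) := differentiable_snd
  have A := differentiable_matrix_iff.1 (differentiable_matrix_mul h1 h2)
  have B := differentiable_matrix_iff.1 (differentiable_matrix_mul
    (differentiable_matrix_mul h1 (differentiable_const β⁻¹)) (differentiable_matrix_transpose h1))
  have C := differentiable_matrix_iff.1 (differentiable_matrix_mul
    (differentiable_matrix_mul (differentiable_matrix_transpose h2) (differentiable_const β)) h2)
  have D := differentiable_matrix_iff.1 (differentiable_matrix_mul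
    (differentiable_matrix_transpose h2) (differentiable_matrix_transpose h1))
  refine differentiable_matrix_iff.2 ?_
  rintro (i | i) (j | j)
  · exact A i j
  · exact B i j
  · exact C i j
  · exact D i j

theorem QMat_invariant {n p : ℕ} (β : Matrix (Fin n) (Fin n) ℂ) :
    ∀ g ∈ isomGroup β, ∀ v : VSpace n p, QMat β (gact g v) = QMat β v := by
  intro g hg v
  have hg' : (g : Matrix (Fin n) (Fin n) ℂ)ᵀ * β * (g : Matrix (Fin n) (Fin n) ℂ) = β := hg
  have hginv : (↑g⁻¹ : Matrix (Fin n) (Fin n) ℂ) * β⁻¹ * (↑g⁻¹ : Matrix (Fin n) (Fin n) ℂ)ᵀ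
      = β⁻¹ := by
    have := congrArg (fun M => M⁻¹) hg'
    simp only [Matrix.mul_inv_rev] at this
    rw [← Matrix.transpose_nonsing_inv, ← Matrix.coe_units_inv] at this
    rw [Matrix.mul_assoc]
    exact this
  have hA := gact_mul g v
  have hB : (gact g v).1 * β⁻¹ * (gact g v).1ᵀ = v.1 * β⁻¹ * v.1ᵀ := by
    calc _ = v.1 * ((↑g⁻¹ : Matrix (Fin n) (Fin n) ℂ) * β⁻¹ *
          (↑g⁻¹ : Matrix (Fin n) (Fin n) ℂ)ᵀ) * v.1ᵀ := by
          simp only [gact, transpose_mul, Matrix.mul_assoc]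
      _ = _ := by rw [hginv]
  have hC : (gact g v).2ᵀ * β * (gact g v).2 = v.2ᵀ * β * v.2 := by
    calc _ = v.2ᵀ * ((g : Matrix (Fin n) (Fin n) ℂ)ᵀ * β * (g : Matrix (Fin n) (Fin n) ℂ)) *
          v.2 := by simp only [gact, transpose_mul, Matrix.mul_assoc]
      _ = _ := by rw [hg']
  have hD : (gact g v).2ᵀ * (gact g v).1ᵀ = v.2ᵀ * v.1ᵀ := by
    rw [← transpose_mul, ← transpose_mul, hA]
  simp only [QMat, hA, hB, hC, hD]

theorem QMat_mem_S {n p : ℕ} {β : Matrix (Fin n) (Fin n) ℂ} (hs : βᵀ = β) (v : VSpace n p) :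
    QMat β v ∈ SymB (formS p) := by
  rw [mem_SymB_iff]
  simp [QMat, formS, fromBlocks_transpose, fromBlocks_multiply, Matrix.transpose_nonsing_inv, hs,
    Matrix.mul_assoc]

theorem QMat_mem_A {n p : ℕ} {β : Matrix (Fin n) (Fin n) ℂ} (ha : βᵀ = -β)
    (hβ : IsUnit β.det) (v : VSpace n p) :
    QMat β v ∈ SymB (formA p) := by
  have hi : (β⁻¹)ᵀ = -β⁻¹ := by
    rw [Matrix.transpose_nonsing_inv, ha]
    refine Matrix.inv_eq_right_inv ?_
    rw [neg_mul_neg, Matrix.mul_nonsing_inv _ hβ]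
  rw [mem_SymB_iff]
  simp [QMat, formA, fromBlocks_transpose, fromBlocks_multiply, ha, hi, Matrix.mul_assoc]

theorem differentiable_codRestrict {n p : ℕ} {M : Type} [NormedAddCommGroup M] [NormedSpace ℂ M]
    [FiniteDimensional ℂ M] (W : Submodule ℂ M) (f : VSpace n p → M) (h : ∀ v, f v ∈ W)
    (hf : Differentiable ℂ f) : Differentiable ℂ (fun v => (⟨f v, h v⟩ : W)) := by
  obtain ⟨π, hπ⟩ := W.subtype.exists_leftInverse_of_injective (LinearMap.ker_eq_bot.2
    W.subtype_injective)
  have : (fun v => (⟨f v, h v⟩ : W)) = fun v => LinearMap.toContinuousLinearMap π (f v) := by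
    funext v
    exact (LinearMap.congr_fun hπ ⟨f v, h v⟩).symm
  rw [this]
  exact (ContinuousLinearMap.differentiable _).comp hf

/-- `Q : V → W = Sym_s(U)` for `G = O_n`. -/
noncomputable def QO {n p : ℕ} (β : Matrix (Fin n) (Fin n) ℂ) (hs : βᵀ = β) (v : VSpace n p) :
    SymB (formS p) := ⟨QMat β v, QMat_mem_S hs v⟩

/-- `Q : V → W = Sym_a(U)` for `G = Sp_n`. -/
noncomputable def QSp {n p : ℕ} (β : Matrix (Fin n) (Fin n) ℂ) (ha : βᵀ = -β) (hβ : IsUnit β.det)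
    (v : VSpace n p) : SymB (formA p) := ⟨QMat β v, QMat_mem_A ha hβ v⟩

/-- `Q^* : 𝒪(W) → 𝒪(V)^G` for `G = GL_n`, `W = End(ℂᵖ)`. -/
noncomputable def QstarGL (n p : ℕ) :
    Hol (Matrix (Fin p) (Fin p) ℂ) →ₐ[ℂ] HolInv (⊤ : Subgroup (GL (Fin n) ℂ)) p :=
  pullback ⊤ QGL QGL_differentiable (fun g _ v => gact_mul g v)

/-- `Q^* : 𝒪(W) → 𝒪(V)^G` for `G = O_n`, `W = Sym_s(U)`. -/
noncomputable def QstarO {n : ℕ} (p : ℕ) (β : Matrix (Fin n) (Fin n) ℂ) (hs : βᵀ = β) :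
    Hol (SymB (formS p)) →ₐ[ℂ] HolInv (isomGroup β) p :=
  pullback (isomGroup β) (QO β hs)
    (differentiable_codRestrict _ _ (QMat_mem_S hs) (QMat_differentiable β))
    (fun g hg v => Subtype.ext (QMat_invariant β g hg v))

/-- `Q^* : 𝒪(W) → 𝒪(V)^G` for `G = Sp_n`, `W = Sym_a(U)`. -/
noncomputable def QstarSp {n : ℕ} (p : ℕ) (β : Matrix (Fin n) (Fin n) ℂ) (ha : βᵀ = -β) (hβ : IsUnit β.det) :
    Hol (SymB (formA p)) →ₐ[ℂ] HolInv (isomGroup β) p :=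
  pullback (isomGroup β) (QSp β ha hβ)
    (differentiable_codRestrict _ _ (QMat_mem_A ha hβ) (QMat_differentiable β))
    (fun g hg v => Subtype.ext (QMat_invariant β g hg v))

/-! Only invariance under a compact subgroup `K` of `G` is used. `K` arises as the unitary elements
of a real `*`-algebra `R` of matrices on which the conjugate transpose agrees with `A ↦ β' Aᵗ β`.
This second map is polynomial in `A`, so identities proved on `R` extend holomorphically to `R +
iR`.

Expand an entire invariant `f` as `∑ c_j l_j(v)^{d_j}` with linear forms `l_j` in a fixed bounded
set and `∑ |c_j| R^{d_j}` finite for every `R` (`exists_hasSum_pow_linear_form`). Realise `v` as a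
matrix `X`, so that `l_j(v) = tr(X Y_j)`, and average over `K`. This gives `f(v) = ∑ c_j h_{d_j}(X
Y_j)` with `h_d(A) = ∫_K tr(kA)^d dk`, which reduces everything to left `K`-invariant functions `h`
of one square matrix.

Such an `h` is a holomorphic function of `M = β' Aᵗ β A`. On invertible elements of `R`, `M = A*A`
and polar decomposition gives `h(A) = h(√M)`. The root has branch points, but `h` does not see the
signs of its eigenvalues, so `ζ ↦ h(√(M + ζ))` is entire and its value at `0` is its mean over a
large circle. There the root is a convergent power series in `M`; the mean is therefore holomorphic
in `M`, with bounds good enough to sum over `j` (`sqrtDescent`). Hence `f` is a holomorphic function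
of the Gram matrix `Xᵗ β X` (`exists_differentiable_gram`), whose blocks are those of `Q` up to
order and sign.

For `O_n` and `Sp_n`, `R` is the commutant of a real or quaternionic structure. For `GL_n` it
consists of the matrices `diag(Ā, A)`. -/

/-! ### Holomorphic dependence of integrals and series on parameters -/

/-- An integral of a uniformly dominated family of holomorphic functions is differentiable. -/
theorem differentiableAt_integral_of_dominated {E : Type*} [NormedAddCommGroup E]
    [NormedSpace ℂ E] [FiniteDimensional ℂ E] {Ω : Type*} [MeasurableSpace Ω]
    {μ : MeasureTheory.Measure Ω} {H : E → Ω → ℂ} {x₀ : E} {r : ℝ} (hr : 0 < r)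
    (hmeas : ∀ x ∈ Metric.ball x₀ r, MeasureTheory.AEStronglyMeasurable (H x) μ)
    (hd : ∀ ω, DifferentiableOn ℂ (fun x => H x ω) (Metric.ball x₀ r))
    {g : Ω → ℝ} (hg : MeasureTheory.Integrable g μ)
    (hb : ∀ ω, ∀ x ∈ Metric.ball x₀ r, ‖H x ω‖ ≤ g ω) :
    DifferentiableAt ℂ (fun x => ∫ ω, H x ω ∂μ) x₀ := by
  have hx₀ : x₀ ∈ Metric.ball x₀ r := Metric.mem_ball_self hr
  have hder : ∀ ω, ∀ x ∈ Metric.ball x₀ (r / 2),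
      HasFDerivAt (fun x => H x ω) (fderiv ℂ (fun x => H x ω) x) x := fun ω x hx =>
    ((hd ω x (Metric.ball_subset_ball (by linarith) hx)).differentiableAt
      (Metric.isOpen_ball.mem_nhds (Metric.ball_subset_ball (by linarith) hx))).hasFDerivAt
  -- Cauchy estimate on a ball of radius `r / 2` around `x`, where values differ from `H x ω` by at
  -- most `2 g ω`.
  have hbound : ∀ ω, ∀ x ∈ Metric.ball x₀ (r / 2),
      ‖fderiv ℂ (fun x => H x ω) x‖ ≤ 2 * g ω / (r / 2) := by
    intro ω x hx
    have hsub : Metric.ball x (r / 2) ⊆ Metric.ball x₀ r := by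
      refine Metric.ball_subset_ball' ?_
      have := Metric.mem_ball.1 hx
      linarith
    refine Complex.norm_fderiv_le_div_of_mapsTo_ball ((hd ω).mono hsub) ?_ (half_pos hr)
    intro y hy
    have h1 := hb ω y (hsub hy)
    have h2 := hb ω x (hsub (Metric.mem_ball_self (half_pos hr)))
    rw [Metric.mem_closedBall, dist_eq_norm]
    have h3 := norm_sub_le (H y ω) (H x ω)
    linarith
  -- Measurability of the derivative in `ω` comes from that of `H`: in a basis, each coordinate is a
  -- pointwise limit of difference quotients with step `s / (n + 1)`, where `s` keeps all the points
  -- inside the ball.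
  have hF' : MeasureTheory.AEStronglyMeasurable (fun ω => fderiv ℂ (fun x => H x ω) x₀) μ := by
    let b := Module.finBasis ℂ E
    have hexp : (fun ω => fderiv ℂ (fun x => H x ω) x₀) = fun ω => ∑ i,
        (fderiv ℂ (fun x => H x ω) x₀ (b i)) • LinearMap.toContinuousLinearMap (b.coord i) := by
      funext ω
      refine ContinuousLinearMap.coe_injective (b.ext fun j => ?_)
      simp [Finsupp.single_apply]
    rw [hexp]
    refine Finset.aestronglyMeasurable_fun_sum _ fun i _ => ?_
    refine MeasureTheory.AEStronglyMeasurable.smul_const ?_ _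
    obtain ⟨s, hs, hsb⟩ : ∃ s : ℝ, 0 < s ∧ s * ‖b i‖ < r :=
      ⟨r / (2 * (‖b i‖ + 1)), by positivity, by
        have := norm_nonneg (b i)
        rw [div_mul_eq_mul_div, div_lt_iff₀ (by positivity)]
        nlinarith⟩
    have hin : ∀ n : ℕ, x₀ + ((s / (n + 1) : ℝ) : ℂ) • b i ∈ Metric.ball x₀ r := by
      intro n
      rw [Metric.mem_ball, dist_eq_norm, add_sub_cancel_left, norm_smul, Complex.norm_real,
        Real.norm_of_nonneg (by positivity)]
      refine lt_of_le_of_lt ?_ hsb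
      gcongr
      exact div_le_self hs.le (by linarith [(Nat.cast_nonneg n : (0 : ℝ) ≤ n)])
    refine aestronglyMeasurable_of_tendsto_ae Filter.atTop
      (f := fun (n : ℕ) ω => ((s / (n + 1) : ℝ) : ℂ)⁻¹ •
        (H (x₀ + ((s / (n + 1) : ℝ) : ℂ) • b i) ω - H x₀ ω)) ?_ ?_
    · intro n
      have h := ((hmeas _ (hin n)).sub (hmeas _ hx₀)).const_smul (((s / (n + 1) : ℝ) : ℂ)⁻¹)
      exact h
    · refine Filter.Eventually.of_forall fun ω => ?_
      have hl := (hder ω x₀ (Metric.mem_ball_self (half_pos hr))).hasLineDerivAt (b i)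
      have := hl.tendsto_slope_zero
      refine this.comp (tendsto_nhdsWithin_iff.2 ⟨?_, ?_⟩)
      · have h0 : Filter.Tendsto (fun n : ℕ => s * (1 / ((n : ℝ) + 1))) Filter.atTop
            (nhds (s * 0)) := tendsto_one_div_add_atTop_nhds_zero_nat.const_mul s
        rw [mul_zero] at h0
        have h1 := (Complex.continuous_ofReal.tendsto 0).comp h0
        simpa [Function.comp_def, div_eq_mul_inv] using h1
      · refine Filter.Eventually.of_forall fun n => ?_
        have : (s / ((n : ℝ) + 1)) ≠ 0 := by positivity
        exact Complex.ofReal_ne_zero.2 this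
  have hint : MeasureTheory.Integrable (H x₀) μ :=
    hg.mono' (hmeas x₀ hx₀) (Filter.Eventually.of_forall fun ω => hb ω x₀ hx₀)
  exact (hasFDerivAt_integral_of_dominated_of_fderiv_le
    (Metric.ball_mem_nhds x₀ (half_pos hr))
    (Filter.eventually_of_mem (Metric.ball_mem_nhds x₀ hr) hmeas) hint hF'
    (Filter.Eventually.of_forall hbound) ((hg.const_mul 2).div_const _)
    (Filter.Eventually.of_forall hder)).differentiableAt

/-- A dominated series of holomorphic functions is differentiable. -/
theorem differentiableAt_tsum_of_dominated {E : Type*} [NormedAddCommGroup E]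
    [NormedSpace ℂ E] [FiniteDimensional ℂ E] {J : Type*} [Countable J] {H : J → E → ℂ}
    (hd : ∀ j, Differentiable ℂ (H j)) {x₀ : E} {r : ℝ} (hr : 0 < r) {g : J → ℝ}
    (hg : Summable g) (hb : ∀ j, ∀ x ∈ Metric.ball x₀ r, ‖H j x‖ ≤ g j) :
    DifferentiableAt ℂ (fun x => ∑' j, H j x) x₀ := by
  -- A series is an integral against counting measure.
  let : MeasurableSpace J := ⊤
  have : DiscreteMeasurableSpace J := ⟨fun _ => trivial⟩
  have key := differentiableAt_integral_of_dominated (μ := MeasureTheory.Measure.count)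
    (H := fun x j => H j x) hr
    (fun x _ => (measurable_of_countable _).aestronglyMeasurable)
    (fun j => (hd j).differentiableOn) (g := g)
    (MeasureTheory.integrable_count_iff.2 hg.norm) hb
  refine key.congr_of_eventuallyEq ?_
  filter_upwards [Metric.ball_mem_nhds x₀ hr] with x hx
  have hs : MeasureTheory.Integrable (fun j => H j x) MeasureTheory.Measure.count :=
    MeasureTheory.integrable_count_iff.2 (hg.of_nonneg_of_le (fun _ => norm_nonneg _)
      fun j => hb j x hx)
  rw [MeasureTheory.integral_countable hs]
  simp

/-- Circle averages of a holomorphic family, continuous in the circle variable, are holomorphic. -/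
theorem differentiableAt_circleAverage {E : Type*} [NormedAddCommGroup E]
    [NormedSpace ℂ E] [FiniteDimensional ℂ E] {H : E → ℂ → ℂ} {x₀ : E} {r ρ C : ℝ} (hr : 0 < r)
    (hcont : ∀ x ∈ Metric.ball x₀ r, Continuous fun θ : ℝ => H x (circleMap 0 ρ θ))
    (hd : ∀ θ : ℝ, DifferentiableOn ℂ (fun x => H x (circleMap 0 ρ θ)) (Metric.ball x₀ r))
    (hb : ∀ θ : ℝ, ∀ x ∈ Metric.ball x₀ r, ‖H x (circleMap 0 ρ θ)‖ ≤ C) :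
    DifferentiableAt ℂ (fun x => Real.circleAverage (H x) 0 ρ) x₀ := by
  have h := differentiableAt_integral_of_dominated
    (μ := MeasureTheory.volume.restrict (Set.Ioc 0 (2 * Real.pi)))
    (H := fun x θ => H x (circleMap 0 ρ θ)) hr (fun x hx => (hcont x hx).aestronglyMeasurable)
    hd (g := fun _ => C) (MeasureTheory.integrable_const C) hb
  simp only [Real.circleAverage_def, intervalIntegral.integral_of_le Real.two_pi_pos.le]
  exact h.const_smul _

theorem norm_circleAverage_le {g : ℂ → ℂ} {ρ C : ℝ} (h : ∀ θ : ℝ, ‖g (circleMap 0 ρ θ)‖ ≤ C) :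
    ‖Real.circleAverage g 0 ρ‖ ≤ C := by
  rw [Real.circleAverage_def, norm_smul, Real.norm_of_nonneg (by positivity)]
  have := intervalIntegral.norm_integral_le_of_norm_le_const (a := 0) (b := 2 * Real.pi)
    (f := fun θ => g (circleMap 0 ρ θ)) (C := C) (fun θ _ => h θ)
  rw [sub_zero, abs_of_pos Real.two_pi_pos] at this
  rw [inv_mul_le_iff₀ Real.two_pi_pos]
  linarith

/-- The partial derivative of a holomorphic function of several variables is holomorphic. -/
theorem differentiable_partial_deriv {E : Type*} [NormedAddCommGroup E] [NormedSpace ℂ E]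
    [FiniteDimensional ℂ E] {F : ℂ × E → ℂ} (hF : Differentiable ℂ F) :
    Differentiable ℂ (fun p : ℂ × E => deriv (fun w => F (w, p.2)) p.1) := by
  have hslice : ∀ z : E, Differentiable ℂ fun w => F (w, z) := fun z =>
    hF.comp (differentiable_id.prodMk (differentiable_const z))
  -- Cauchy's formula on the unit circle around `p.1` turns the derivative into an integral of `F`
  -- over a fixed parameter interval.
  have hform : (fun p : ℂ × E => deriv (fun w => F (w, p.2)) p.1) = fun p : ℂ × E =>
      (2 * Real.pi * Complex.I : ℂ)⁻¹ • ∫ θ in Set.Ioc 0 (2 * Real.pi),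
        deriv (circleMap 0 1) θ • (((circleMap 0 1 θ) ^ 2)⁻¹ •
          F (p.1 + circleMap 0 1 θ, p.2)) := by
    funext p
    have h2 : (2 * Real.pi * Complex.I : ℂ) ≠ 0 := Complex.two_pi_I_ne_zero
    have h := (hslice p.2).diffContOnCl.deriv_eq_smul_circleIntegral (c := p.1) one_pos
    rw [eq_inv_smul_iff₀ h2, ← h, circleIntegral,
      intervalIntegral.integral_of_le Real.two_pi_pos.le]
    simp [circleMap]
  rw [hform]
  refine Differentiable.fun_const_smul (fun p => ?_) _
  obtain ⟨C, hC⟩ := (isCompact_closedBall (0 : ℂ × E) (‖p‖ + 2)).exists_bound_of_continuousOn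
    hF.continuous.continuousOn
  have hcm : ∀ θ, circleMap 0 1 θ ≠ 0 := fun θ => circleMap_ne_center one_ne_zero
  refine differentiableAt_integral_of_dominated (r := 1) one_pos (g := fun _ => C) ?_ ?_
    (MeasureTheory.integrable_const C) ?_
  · intro x _
    refine Continuous.aestronglyMeasurable ?_
    have h1 : Continuous fun θ => F (x.1 + circleMap 0 1 θ, x.2) :=
      hF.continuous.comp ((continuous_const.add (continuous_circleMap 0 1)).prodMk
        continuous_const)
    have h2 : Continuous fun θ => ((circleMap 0 1 θ) ^ 2)⁻¹ :=
      ((continuous_circleMap 0 1).pow 2).inv₀ fun θ => pow_ne_zero 2 (hcm θ)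
    have h3 : Continuous (deriv (circleMap 0 1)) := by
      have : deriv (circleMap 0 1) = fun θ => circleMap 0 1 θ * Complex.I := by
        funext θ; rw [deriv_circleMap]
      rw [this]
      exact (continuous_circleMap 0 1).mul continuous_const
    exact h3.smul (h2.smul h1)
  · intro θ
    refine Differentiable.differentiableOn ?_
    have h1 : Differentiable ℂ fun x : ℂ × E => (x.1 + circleMap 0 1 θ, x.2) := by fun_prop
    exact Differentiable.fun_const_smul (Differentiable.fun_const_smul (hF.comp h1) _) _
  · intro θ x hx
    have hx1 : ‖x‖ ≤ ‖p‖ + 1 := by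
      have h1 := norm_le_norm_add_norm_sub' x p
      have h2 : ‖x - p‖ < 1 := by rwa [Metric.mem_ball, dist_eq_norm] at hx
      linarith
    have hc1 : ‖circleMap 0 1 θ‖ = 1 := by simp
    have : ‖(x.1 + circleMap 0 1 θ, x.2)‖ ≤ ‖p‖ + 2 := by
      rw [Prod.norm_def]
      refine max_le ((norm_add_le _ _).trans ?_) ((norm_snd_le x).trans (by linarith))
      rw [hc1]
      linarith [norm_fst_le x]
    simpa [norm_smul] using hC _ (by simpa using this)

theorem differentiable_iteratedDeriv_slice {E : Type*} [NormedAddCommGroup E] [NormedSpace ℂ E]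
    [FiniteDimensional ℂ E] {F : ℂ × E → ℂ} (hF : Differentiable ℂ F) (k : ℕ) (w : ℂ) :
    Differentiable ℂ (fun z => iteratedDeriv k (fun w => F (w, z)) w) := by
  have key : ∀ k, Differentiable ℂ
      (fun p : ℂ × E => iteratedDeriv k (fun w => F (w, p.2)) p.1) := by
    intro k
    induction k with
    | zero => simpa using hF
    | succ k ih =>
      have := differentiable_partial_deriv ih
      simpa only [iteratedDeriv_succ] using this
  exact (key k).comp ((differentiable_const w).prodMk differentiable_id)

/-! ### Entire functions as sums of powers of linear forms -/

/-- A product of two powers is an absolutely bounded combination of powers of linear forms. -/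
theorem exists_mul_pow_eq_sum_pow (k d : ℕ) : ∃ b u : Fin (k + d + 1) → ℂ,
    (∀ s, ‖u s‖ ≤ 1) ∧ ∑ s, ‖b s‖ ≤ 1 ∧
    ∀ t l : ℂ, t ^ k * l ^ d = ∑ s, b s * (u s * t + l) ^ (k + d) := by
  set n := k + d with hn
  have hn0 : (n : ℂ) + 1 ≠ 0 := Nat.cast_add_one_ne_zero n
  set ω : ℂ := Complex.exp (2 * Real.pi * Complex.I / ((n + 1 : ℕ) : ℂ)) with hω
  have hprim : IsPrimitiveRoot ω (n + 1) := Complex.isPrimitiveRoot_exp (n + 1) n.succ_ne_zero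
  have hω0 : ω ≠ 0 := Complex.exp_ne_zero _
  have hnorm : ‖ω‖ = 1 := Complex.norm_eq_one_of_pow_eq_one hprim.pow_eq_one n.succ_ne_zero
  -- Discrete Fourier inversion: averaging `ω^{-ks} (ω^s t + l)^n` over the `(n+1)`-th roots of
  -- unity isolates the term `C(n,k) t^k l^{n-k}`. No two exponents in `0, …, n` are congruent mod
  -- `n + 1`.
  have horth : ∀ m ∈ Finset.range (n + 1), ∑ s : Fin (n + 1), (ω⁻¹ ^ k) ^ (s : ℕ) *
      (ω ^ (s : ℕ)) ^ m = if m = k then (n : ℂ) + 1 else 0 := by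
    intro m hm
    have hq : ∀ s : Fin (n + 1), (ω⁻¹ ^ k) ^ (s : ℕ) * (ω ^ (s : ℕ)) ^ m
        = (ω⁻¹ ^ k * ω ^ m) ^ (s : ℕ) := fun s => by
      rw [mul_pow, ← pow_mul ω, ← pow_mul ω, mul_comm (s : ℕ) m]
    simp only [hq]
    rw [Fin.sum_univ_eq_sum_range fun s => (ω⁻¹ ^ k * ω ^ m) ^ s]
    split_ifs with h
    · subst h
      simp [hω0]
    · have hne : ω⁻¹ ^ k * ω ^ m ≠ 1 := by
        intro h1
        rw [inv_pow, inv_mul_eq_one₀ (pow_ne_zero _ hω0)] at h1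
        exact h (hprim.pow_inj (Finset.mem_range.1 hm) (by omega) h1.symm)
      have hpow : (ω⁻¹ ^ k * ω ^ m) ^ (n + 1) = 1 := by
        rw [mul_pow, ← pow_mul, ← pow_mul, mul_comm k, mul_comm m, pow_mul, pow_mul, inv_pow,
          hprim.pow_eq_one]
        simp
      have := mul_neg_geom_sum (ω⁻¹ ^ k * ω ^ m) (n + 1)
      rw [hpow, sub_self] at this
      exact (mul_eq_zero.1 this).resolve_left (sub_ne_zero.2 (Ne.symm hne))
  have hch : ((n.choose k : ℕ) : ℂ) ≠ 0 :=
    Nat.cast_ne_zero.2 (Nat.choose_pos (by omega)).ne'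
  refine ⟨fun s => ((n : ℂ) + 1)⁻¹ * ((n.choose k : ℕ) : ℂ)⁻¹ * (ω⁻¹ ^ k) ^ (s : ℕ),
    fun s => ω ^ (s : ℕ), fun s => by simp [hnorm], ?_, ?_⟩
  · simp only [norm_mul, norm_pow, norm_inv, hnorm, inv_one, one_pow, mul_one, Finset.sum_const,
      Finset.card_univ, Fintype.card_fin, nsmul_eq_mul]
    have h1 : ‖(n : ℂ) + 1‖ = n + 1 := by
      rw [← Nat.cast_add_one, Complex.norm_natCast]
      push_cast; ring
    rw [h1, Complex.norm_natCast, ← mul_assoc]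
    push_cast
    rw [mul_inv_cancel₀ (by positivity), one_mul]
    exact inv_le_one_of_one_le₀ (by exact_mod_cast Nat.choose_pos (by omega))
  · intro t l
    have hexp : ∀ s : Fin (n + 1), ((n : ℂ) + 1)⁻¹ * ((n.choose k : ℕ) : ℂ)⁻¹ *
        (ω⁻¹ ^ k) ^ (s : ℕ) * (ω ^ (s : ℕ) * t + l) ^ n =
        ∑ m ∈ Finset.range (n + 1), ((n : ℂ) + 1)⁻¹ * ((n.choose k : ℕ) : ℂ)⁻¹ *
          (t ^ m * l ^ (n - m) * (n.choose m : ℕ)) *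
          ((ω⁻¹ ^ k) ^ (s : ℕ) * (ω ^ (s : ℕ)) ^ m) := by
      intro s
      rw [add_pow, Finset.mul_sum]
      refine Finset.sum_congr rfl fun m _ => ?_
      rw [mul_pow]
      ring
    simp only [hexp]
    rw [Finset.sum_comm]
    simp only [← Finset.mul_sum]
    rw [Finset.sum_congr rfl fun m hm => by rw [horth m hm]]
    rw [Finset.sum_eq_single k (fun m _ hm => by simp [hm])
      (fun h => absurd (Finset.mem_range.2 (by omega)) h)]
    have : n - k = d := by omega
    rw [if_pos rfl, this]
    field_simp

open scoped ENNReal NNReal in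
theorem summable_of_tsum_enorm_mul_pow_ne_top {J : Type*} {c : J → ℂ} {d : J → ℕ} {R : ℝ≥0}
    (h : ∑' j, ‖c j‖ₑ * (R : ℝ≥0∞) ^ d j ≠ ⊤) : Summable fun j => ‖c j‖ * (R : ℝ) ^ d j := by
  have h1 : Summable fun j => ‖c j‖₊ * R ^ d j := by
    refine ENNReal.tsum_coe_ne_top_iff_summable.1 ?_
    simpa [enorm_eq_nnnorm] using h
  have h2 := NNReal.summable_coe.2 h1
  push_cast at h2
  exact h2

open scoped ENNReal NNReal in
/-- An entire function of several variables is a superposition of powers of linear forms, with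
quantitative control. -/
theorem exists_hasSum_pow_linear_form_aux (N : ℕ) : ∀ f : (Fin N → ℂ) → ℂ, Differentiable ℂ f →
    ∃ (J : Type) (_ : Countable J) (c : J → ℂ) (y : J → Fin N → ℂ) (d : J → ℕ),
      (∀ j i, ‖y j i‖ ≤ 1) ∧
      (∀ R B : ℝ≥0, 0 < R → (∀ z, ‖z‖ ≤ 2 ^ N * R → ‖f z‖ ≤ B) →
        ∑' j, ‖c j‖ₑ * (R : ℝ≥0∞) ^ d j ≤ 2 ^ N * B) ∧
      ∀ z, HasSum (fun j => c j * (∑ i, y j i * z i) ^ d j) (f z) := by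
  induction N with
  | zero =>
    intro f _
    refine ⟨Unit, inferInstance, fun _ => f 0, fun _ => 0, fun _ => 0, by simp, ?_, ?_⟩
    · intro R B _ h
      have := h 0 (by rw [norm_zero]; positivity)
      simp only [tsum_fintype, Finset.univ_unique, Finset.sum_const, Finset.card_singleton,
        pow_zero, mul_one, one_mul, one_smul]
      rw [enorm_eq_nnnorm]
      exact_mod_cast this
    · intro z
      have : z = 0 := Subsingleton.elim _ _
      subst this
      simp
  | succ N ih =>
    intro f hf
    set F : ℂ × (Fin N → ℂ) → ℂ := fun p => f (Fin.cons p.1 p.2) with hFdef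
    have hF : Differentiable ℂ F := by
      refine hf.comp (differentiable_pi.2 fun i => ?_)
      refine Fin.cases ?_ (fun i => ?_) i
      · simp only [Fin.cons_zero]
        fun_prop
      · simp only [Fin.cons_succ]
        fun_prop
    have hslice : ∀ z, Differentiable ℂ fun w => F (w, z) := fun z =>
      hF.comp (differentiable_id.prodMk (differentiable_const z))
    -- Taylor coefficients in the first variable; the induction hypothesis applies to each of them.
    set fk : ℕ → (Fin N → ℂ) → ℂ := fun k z =>
      ((k.factorial : ℕ) : ℂ)⁻¹ * iteratedDeriv k (fun w => F (w, z)) 0 with hfk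
    have hfkd : ∀ k, Differentiable ℂ (fk k) := fun k =>
      (differentiable_iteratedDeriv_slice hF k 0).const_mul _
    have hfksum : ∀ w z, HasSum (fun k => w ^ k * fk k z) (F (w, z)) := by
      intro w z
      have := Complex.hasSum_taylorSeries_of_entire (hslice z) 0 w
      refine this.congr_fun fun k => ?_
      simp only [hfk, sub_zero, smul_eq_mul]
      ring
    -- Cauchy estimates on the circle of radius `2R` leave a factor `2^{-k}` after multiplication by
    -- `R^k`. Its geometric sum `2` is the price of one variable, which explains the `2^N` in the
    -- bound; the `2^N` in the radius leaves room for that circle.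
    have hfkb : ∀ R B : ℝ≥0, 0 < R → (∀ z, ‖z‖ ≤ 2 ^ (N + 1) * R → ‖f z‖ ≤ B) → ∀ k z,
        ‖z‖ ≤ 2 ^ N * R → ‖fk k z‖ ≤ (B / (2 * R) ^ k : ℝ≥0) := by
      intro R B hR h k z hz
      have hR' : (0 : ℝ) < R := hR
      have h2N : (1 : ℝ) ≤ 2 ^ N := one_le_pow₀ (by norm_num)
      have hle := Complex.norm_iteratedDeriv_le_of_forall_mem_sphere_norm_le (n := k)
        (R := 2 * R) (C := B) (c := 0) (by positivity)
        (hslice z).diffContOnCl (fun w hw => h _ ?_)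
      · rw [hfk]
        simp only [norm_mul, norm_inv, Complex.norm_natCast]
        rw [inv_mul_le_iff₀ (by positivity)]
        push_cast
        rw [← mul_div_assoc]
        exact hle
      · rw [pi_norm_le_iff_of_nonneg (by positivity)]
        refine Fin.cases ?_ (fun i => ?_)
        · simp only [Fin.cons_zero]
          rw [mem_sphere_zero_iff_norm.1 hw]
          rw [pow_succ]
          nlinarith
        · simp only [Fin.cons_succ]
          refine (norm_le_pi_norm z i).trans (hz.trans ?_)
          rw [pow_succ]
          nlinarith
    choose J hJ c y d hy hcb hsum using fun k => ih (fk k) (hfkd k)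
    choose b u hu hb hbu using exists_mul_pow_eq_sum_pow
    have := hJ
    have hy' : ∀ (p : Σ k, Σ j : J k, Fin (k + d k j + 1)) i,
        ‖(Fin.cons (u p.1 (d p.1 p.2.1) p.2.2) (y p.1 p.2.1) : Fin (N + 1) → ℂ) i‖ ≤ 1 := by
      rintro ⟨k, j, s⟩ i
      refine Fin.cases ?_ (fun i => ?_) i
      · simpa using hu _ _ _
      · simpa using hy _ _ _
    refine ⟨Σ k, Σ j : J k, Fin (k + d k j + 1), inferInstance,
      fun p => c p.1 p.2.1 * b p.1 (d p.1 p.2.1) p.2.2,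
      fun p => Fin.cons (u p.1 (d p.1 p.2.1) p.2.2) (y p.1 p.2.1),
      fun p => p.1 + d p.1 p.2.1, hy', ?_⟩
    have hbound : ∀ R B : ℝ≥0, 0 < R → (∀ z, ‖z‖ ≤ 2 ^ (N + 1) * R → ‖f z‖ ≤ B) →
        ∑' p : Σ k, Σ j : J k, Fin (k + d k j + 1), ‖c p.1 p.2.1 * b p.1 (d p.1 p.2.1) p.2.2‖ₑ *
          (R : ℝ≥0∞) ^ (p.1 + d p.1 p.2.1) ≤ 2 ^ (N + 1) * B := by
      intro R B hR h
      have hbe : ∀ k d, ∑ s, ‖b k d s‖ₑ ≤ 1 := fun k d => by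
        have := hb k d
        simp only [enorm_eq_nnnorm]
        have h2 : ∑ s, ‖b k d s‖₊ ≤ 1 := by rw [← NNReal.coe_le_coe]; push_cast; exact this
        exact_mod_cast h2
      calc _ = ∑' k, ∑' j : J k, ∑ s, (R : ℝ≥0∞) ^ k * (‖c k j‖ₑ * (R : ℝ≥0∞) ^ d k j) *
            ‖b k (d k j) s‖ₑ := by
            rw [ENNReal.tsum_sigma']
            refine tsum_congr fun k => ?_
            rw [ENNReal.tsum_sigma']
            refine tsum_congr fun j => ?_
            rw [tsum_fintype]
            refine Finset.sum_congr rfl fun s _ => ?_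
            rw [enorm_mul, pow_add]
            ring
        _ ≤ ∑' k, (R : ℝ≥0∞) ^ k * (2 ^ N * ((B / (2 * R) ^ k : ℝ≥0) : ℝ≥0∞)) := by
            refine ENNReal.tsum_le_tsum fun k => ?_
            refine le_trans ?_ (mul_le_mul_right (hcb k R _ hR (hfkb R B hR h k)) _)
            rw [← ENNReal.tsum_mul_left]
            refine ENNReal.tsum_le_tsum fun j => ?_
            rw [← Finset.mul_sum]
            exact mul_le_of_le_one_right' (hbe _ _)
        _ = ∑' k : ℕ, 2 ^ N * B * (2⁻¹ : ℝ≥0∞) ^ k := by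
            refine tsum_congr fun k => ?_
            have : (R ^ k * (2 ^ N * (B / (2 * R) ^ k)) : ℝ≥0) = 2 ^ N * B * 2⁻¹ ^ k := by
              have h2 : (2 : ℝ≥0) ^ k * (2⁻¹) ^ k = 1 := by
                rw [← mul_pow, mul_inv_cancel₀ two_ne_zero, one_pow]
              have h3 : R ^ k ≠ 0 := pow_ne_zero _ hR.ne'
              calc _ = 2 ^ N * (B * (R ^ k / (2 * R) ^ k)) := by ring
                _ = _ := by
                  rw [mul_pow, div_mul_cancel_right₀ h3, inv_pow, mul_assoc]
            have h2 : (2⁻¹ : ℝ≥0∞) = ((2⁻¹ : ℝ≥0) : ℝ≥0∞) := by simp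
            rw [h2]
            exact_mod_cast congrArg (fun x : ℝ≥0 => (x : ℝ≥0∞)) this
        _ = 2 ^ (N + 1) * B := by
            rw [ENNReal.tsum_mul_left, ENNReal.tsum_geometric, ENNReal.one_sub_inv_two, inv_inv,
              pow_succ]
            ring
    refine ⟨hbound, fun z => ?_⟩
    have hz : f z = F (z 0, Fin.tail z) := by simp [hFdef]
    have hterm : ∀ p : Σ k, Σ j : J k, Fin (k + d k j + 1),
        c p.1 p.2.1 * b p.1 (d p.1 p.2.1) p.2.2 *
          (∑ i, (Fin.cons (u p.1 (d p.1 p.2.1) p.2.2) (y p.1 p.2.1) : Fin (N + 1) → ℂ) i * z i) ^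
            (p.1 + d p.1 p.2.1) =
        c p.1 p.2.1 * (b p.1 (d p.1 p.2.1) p.2.2 * (u p.1 (d p.1 p.2.1) p.2.2 * z 0 +
          ∑ i, y p.1 p.2.1 i * Fin.tail z i) ^ (p.1 + d p.1 p.2.1)) := fun p => by
      rw [Fin.sum_univ_succ]
      simp only [Fin.cons_zero, Fin.cons_succ, Fin.tail, mul_assoc]
    rw [hz]
    have hS : Summable fun p : Σ k, Σ j : J k, Fin (k + d k j + 1) =>
        c p.1 p.2.1 * (b p.1 (d p.1 p.2.1) p.2.2 * (u p.1 (d p.1 p.2.1) p.2.2 * z 0 +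
          ∑ i, y p.1 p.2.1 i * Fin.tail z i) ^ (p.1 + d p.1 p.2.1)) := by
      -- The radius `R = (N + 1)‖z‖ + 1` is positive and dominates every linear form `∑ y_i z_i`
      -- with `|y_i| ≤ 1`.
      obtain ⟨C, hC⟩ := (isCompact_closedBall (0 : Fin (N + 1) → ℂ)
        (2 ^ (N + 1) * ((N + 1) * ‖z‖ + 1))).exists_bound_of_continuousOn
          hf.continuous.continuousOn
      have h1 := hbound ((N + 1) * ‖z‖₊ + 1) C.toNNReal (by positivity) fun x hx =>
        (hC x (by simpa using hx)).trans (Real.le_coe_toNNReal C)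
      refine Summable.of_norm_bounded (summable_of_tsum_enorm_mul_pow_ne_top
        (h1.trans_lt (by finiteness)).ne) fun p => ?_
      rw [← hterm, norm_mul, norm_pow]
      gcongr
      refine (norm_sum_le _ _).trans ?_
      have h2 : ∀ i, ‖(Fin.cons (u p.1 (d p.1 p.2.1) p.2.2) (y p.1 p.2.1) : Fin (N + 1) → ℂ) i *
          z i‖ ≤ ‖z‖ := fun i => by
        rw [norm_mul]
        exact (mul_le_of_le_one_left (norm_nonneg _) (hy' p i)).trans (norm_le_pi_norm z i)
      refine (Finset.sum_le_sum fun i _ => h2 i).trans ?_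
      simp
    simp only [hterm]
    refine HasSum.sigma_of_hasSum (hfksum (z 0) (Fin.tail z)) (fun k => ?_) hS
    refine HasSum.sigma_of_hasSum ((hsum k (Fin.tail z)).mul_left (z 0 ^ k))
      (fun j => ?_) (hS.sigma_factor k)
    have : z 0 ^ k * (c k j * (∑ i, y k j i * Fin.tail z i) ^ d k j) =
        ∑ s, c k j * (b k (d k j) s * (u k (d k j) s * z 0 + ∑ i, y k j i * Fin.tail z i) ^
          (k + d k j)) := by
      rw [← Finset.mul_sum, ← hbu]
      ring
    rw [this]
    exact hasSum_fintype _

/-- An entire function of several variables is a superposition of powers of linear forms. -/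
theorem exists_hasSum_pow_linear_form {N : ℕ} {f : (Fin N → ℂ) → ℂ} (hf : Differentiable ℂ f) :
    ∃ (J : Type) (_ : Countable J) (c : J → ℂ) (y : J → Fin N → ℂ) (d : J → ℕ),
      (∀ j i, ‖y j i‖ ≤ 1) ∧ (∀ R : ℝ, 0 < R → Summable fun j => ‖c j‖ * R ^ d j) ∧
      ∀ z, HasSum (fun j => c j * (∑ i, y j i * z i) ^ d j) (f z) := by
  obtain ⟨J, hJ, c, y, d, hy, hb, hs⟩ := exists_hasSum_pow_linear_form_aux N f hf
  refine ⟨J, hJ, c, y, d, hy, fun R hR => ?_, hs⟩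
  lift R to NNReal using hR.le
  obtain ⟨C, hC⟩ := (isCompact_closedBall (0 : Fin N → ℂ)
    (2 ^ N * R)).exists_bound_of_continuousOn hf.continuous.continuousOn
  have h1 := hb R C.toNNReal (by exact_mod_cast hR) fun x hx =>
    (hC x (by simpa using hx)).trans (Real.le_coe_toNNReal C)
  exact summable_of_tsum_enorm_mul_pow_ne_top (h1.trans_lt (by finiteness)).ne

/-! ### Matrix norms and the power series for the square root -/

/-- The entrywise sup norm is submultiplicative only up to the size of the matrix. The added `1`
keeps the constant positive, so that one can divide by it, even for an empty index type. -/
theorem norm_matrix_mul_le {l m k : Type*} [Fintype l] [Fintype m] [Fintype k]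
    (A : Matrix l m ℂ) (B : Matrix m k ℂ) : ‖A * B‖ ≤ (Fintype.card m + 1) * ‖A‖ * ‖B‖ := by
  refine (Matrix.norm_le_iff (by positivity)).2 fun i j => ?_
  rw [Matrix.mul_apply]
  calc _ ≤ ∑ x : m, ‖A‖ * ‖B‖ := norm_sum_le_of_le _ fun x _ => by
        rw [norm_mul]
        gcongr
        · exact A.norm_entry_le_entrywise_sup_norm
        · exact B.norm_entry_le_entrywise_sup_norm
    _ = Fintype.card m * ‖A‖ * ‖B‖ := by simp [mul_assoc]
    _ ≤ _ := by gcongr; simp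

theorem norm_matrix_one_le (m : Type*) [Fintype m] [DecidableEq m] :
    ‖(1 : Matrix m m ℂ)‖ ≤ 1 := by
  refine (Matrix.norm_le_iff zero_le_one).2 fun i j => ?_
  rw [Matrix.one_apply]
  split_ifs <;> simp

theorem norm_matrix_pow_le {m : Type*} [Fintype m] [DecidableEq m] (M : Matrix m m ℂ) (k : ℕ) :
    ‖M ^ k‖ ≤ ((Fintype.card m + 1) * ‖M‖) ^ k := by
  induction k with
  | zero => simp [norm_matrix_one_le m]
  | succ k ih =>
    rw [pow_succ, pow_succ]
    refine (norm_matrix_mul_le _ _).trans ?_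
    calc _ ≤ (Fintype.card m + 1) * (((Fintype.card m + 1) * ‖M‖) ^ k) * ‖M‖ := by gcongr
      _ = _ := by ring

theorem differentiable_matrix_pow {m : Type} [Fintype m] [DecidableEq m] (k : ℕ) :
    Differentiable ℂ (fun M : Matrix m m ℂ => M ^ k) := by
  induction k with
  | zero => simp
  | succ k ih =>
    simp only [pow_succ]
    exact differentiable_matrix_mul ih differentiable_id

/-- Taylor coefficients of `√(1 + z)` at the origin. -/
noncomputable def sqrtCoeff (k : ℕ) : ℂ :=
  ((k.factorial : ℕ) : ℂ)⁻¹ * iteratedDeriv k (fun z : ℂ => (1 + z) ^ (1 / 2 : ℂ)) 0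

theorem hasSum_sqrtCoeff {z : ℂ} (hz : ‖z‖ < 1) :
    HasSum (fun k => sqrtCoeff k * z ^ k) ((1 + z) ^ (1 / 2 : ℂ)) := by
  have hd : DifferentiableOn ℂ (fun z : ℂ => (1 + z) ^ (1 / 2 : ℂ)) (Metric.ball 0 1) := by
    intro w hw
    refine DifferentiableAt.differentiableWithinAt ?_
    refine DifferentiableAt.cpow (by fun_prop) (by fun_prop) ?_
    exact Complex.mem_slitPlane_of_norm_lt_one (by simpa using hw)
  refine (Complex.hasSum_taylorSeries_on_ball hd (z := z) (by simpa using hz)).congr_fun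
    fun k => ?_
  simp only [sqrtCoeff, sub_zero, smul_eq_mul]
  ring

theorem summable_sqrtCoeff {r : ℝ} (h0 : 0 ≤ r) (hr : r < 1) :
    Summable fun k => ‖sqrtCoeff k‖ * r ^ k := by
  have := (hasSum_sqrtCoeff (z := (r : ℂ))
    (by rwa [Complex.norm_real, Real.norm_of_nonneg h0])).summable.norm
  simpa [abs_of_nonneg h0] using this

/-- The square root `√(1 + M)` of a matrix, as a power series in `M`. -/
noncomputable def sqrtOneAdd {m : Type} [Fintype m] [DecidableEq m] (M : Matrix m m ℂ) :
    Matrix m m ℂ := Matrix.of fun i j => ∑' k, sqrtCoeff k * (M ^ k) i j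

section
variable {m : Type} [Fintype m] [DecidableEq m]

theorem norm_sqrtCoeff_mul_pow_le {M : Matrix m m ℂ} {r : ℝ}
    (hM : (Fintype.card m + 1) * ‖M‖ ≤ r) (i j : m) (k : ℕ) :
    ‖sqrtCoeff k * (M ^ k) i j‖ ≤ ‖sqrtCoeff k‖ * r ^ k := by
  rw [norm_mul]
  gcongr
  exact ((M ^ k).norm_entry_le_entrywise_sup_norm).trans ((norm_matrix_pow_le M k).trans
    (pow_le_pow_left₀ (by positivity) hM k))

theorem differentiableAt_sqrtOneAdd {M : Matrix m m ℂ}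
    (hM : (Fintype.card m + 1) * ‖M‖ < 1) : DifferentiableAt ℂ sqrtOneAdd M := by
  refine differentiableAt_pi.2 fun i => differentiableAt_pi.2 fun j => ?_
  have hc : (0 : ℝ) < Fintype.card m + 1 := by positivity
  obtain ⟨r, hr1, hr2⟩ := exists_between hM
  have hr0 : 0 ≤ r := le_trans (by positivity) hr1.le
  refine differentiableAt_tsum_of_dominated (r := r / (Fintype.card m + 1) - ‖M‖)
    (fun k => ?_) ?_ (summable_sqrtCoeff hr0 hr2) ?_
  · exact (differentiable_matrix_iff.1 (differentiable_matrix_pow k) i j).const_mul _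
  · rw [sub_pos, lt_div_iff₀ hc]
    linarith
  · intro k x hx
    refine norm_sqrtCoeff_mul_pow_le ?_ i j k
    have h1 := norm_le_norm_add_norm_sub' x M
    have h2 : ‖x - M‖ < r / (Fintype.card m + 1) - ‖M‖ := by
      rwa [Metric.mem_ball, dist_eq_norm] at hx
    have h3 : ‖x‖ ≤ r / (Fintype.card m + 1) := by linarith
    rw [le_div_iff₀ hc] at h3
    linarith

/-- A bound for `√(1 + M)` near the origin. -/
noncomputable def sqrtBound : ℝ := ∑' k, ‖sqrtCoeff k‖ * (1 / 2) ^ k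

theorem sqrtBound_nonneg : 0 ≤ sqrtBound := tsum_nonneg fun _ => by positivity

theorem norm_sqrtOneAdd_le {M : Matrix m m ℂ} (hM : (Fintype.card m + 1) * ‖M‖ ≤ 1 / 2) :
    ‖sqrtOneAdd M‖ ≤ sqrtBound :=
  (Matrix.norm_le_iff sqrtBound_nonneg).2 fun i j =>
    tsum_of_norm_bounded (summable_sqrtCoeff (by norm_num) (by norm_num)).hasSum
      fun k => norm_sqrtCoeff_mul_pow_le hM i j k

theorem sum_smul_idempotent_pow {ι : Type*} [Fintype ι] [DecidableEq ι] {e : ι → Matrix m m ℂ}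
    (he : ∀ i j, e i * e j = if i = j then e i else 0) (hs : ∑ i, e i = 1) (t : ι → ℂ) (k : ℕ) :
    (∑ i, t i • e i) ^ k = ∑ i, t i ^ k • e i := by
  induction k with
  | zero => simp [hs]
  | succ k ih =>
    rw [pow_succ, ih, Finset.sum_mul]
    refine Finset.sum_congr rfl fun i _ => ?_
    rw [Finset.mul_sum, Finset.sum_eq_single i]
    · simp [he, smul_smul, pow_succ, mul_comm]
    · intro j _ hj
      simp [he, hj.symm]
    · simp

theorem sqrtOneAdd_sum_smul_idempotent {ι : Type*} [Fintype ι] [DecidableEq ι]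
    {e : ι → Matrix m m ℂ} (he : ∀ i j, e i * e j = if i = j then e i else 0)
    (hs : ∑ i, e i = 1) {t : ι → ℂ} (ht : ∀ i, ‖t i‖ < 1) :
    sqrtOneAdd (∑ i, t i • e i) = ∑ i, (1 + t i) ^ (1 / 2 : ℂ) • e i := by
  ext a b
  simp only [sqrtOneAdd, Matrix.of_apply, sum_smul_idempotent_pow he hs]
  simp only [Matrix.sum_apply, Matrix.smul_apply, smul_eq_mul, Finset.mul_sum, ← mul_assoc]
  exact (hasSum_sum fun i _ => (hasSum_sqrtCoeff (ht i)).mul_right (e i a b)).tsum_eq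

/-! ### Descent along the matrix square root -/

/-- The average of `h` over the square roots of `M + ζ`, with `ζ = w ^ 2` and `|w| = ρ`. -/
noncomputable def sqrtAverage (h : Matrix m m ℂ → ℂ) (ρ : ℝ) (M : Matrix m m ℂ) : ℂ :=
  Real.circleAverage (fun w => h (w • sqrtOneAdd ((w ^ 2)⁻¹ • M))) 0 ρ

omit [DecidableEq m] in
theorem card_mul_norm_inv_sq_smul_le {w : ℂ} {ρ : ℝ} (hρ : 0 < ρ) (hw : ρ ≤ ‖w‖)
    {M : Matrix m m ℂ} (hM : 2 * ((Fintype.card m + 1) * ‖M‖) ≤ ρ ^ 2) :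
    (Fintype.card m + 1) * ‖(w ^ 2)⁻¹ • M‖ ≤ 1 / 2 := by
  rw [norm_smul, norm_inv, norm_pow]
  have h1 : ρ ^ 2 ≤ ‖w‖ ^ 2 := pow_le_pow_left₀ hρ.le hw 2
  have h2 : 0 < ‖w‖ ^ 2 := lt_of_lt_of_le (by positivity) h1
  calc _ = ((Fintype.card m + 1) * ‖M‖) / ‖w‖ ^ 2 := by field_simp
    _ ≤ _ := by rw [div_le_iff₀ h2]; linarith

theorem differentiableAt_smul_sqrtOneAdd {h : Matrix m m ℂ → ℂ} (hh : Differentiable ℂ h)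
    {w : ℂ} {ρ : ℝ} (hρ : 0 < ρ) (hw : ρ ≤ ‖w‖)
    {M : Matrix m m ℂ} (hM : 2 * ((Fintype.card m + 1) * ‖M‖) ≤ ρ ^ 2) :
    DifferentiableAt ℂ (fun w => h (w • sqrtOneAdd ((w ^ 2)⁻¹ • M))) w := by
  have h1 := card_mul_norm_inv_sq_smul_le hρ hw hM
  have hw0 : w ^ 2 ≠ 0 := pow_ne_zero 2 (norm_pos_iff.1 (hρ.trans_le hw))
  have h2 : DifferentiableAt ℂ (fun w : ℂ => (w ^ 2)⁻¹ • M) w := by fun_prop (disch := assumption)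
  have h3 := DifferentiableAt.comp w
    (differentiableAt_sqrtOneAdd (lt_of_le_of_lt h1 (by norm_num))) h2
  exact (hh _).comp w (differentiableAt_id.smul h3)

/-- The integrand is holomorphic on the annulus between the circles, since `w⁻² M` stays within the
convergence region of the series there. -/
theorem sqrtAverage_radius {h : Matrix m m ℂ → ℂ} (hh : Differentiable ℂ h) {ρ₁ ρ₂ : ℝ}
    (h1 : 0 < ρ₁) (h12 : ρ₁ ≤ ρ₂) {M : Matrix m m ℂ}
    (hM : 2 * ((Fintype.card m + 1) * ‖M‖) ≤ ρ₁ ^ 2) :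
    sqrtAverage h ρ₂ M = sqrtAverage h ρ₁ M := by
  rw [sqrtAverage, sqrtAverage, Real.circleAverage_eq_circleIntegral h1.ne',
    Real.circleAverage_eq_circleIntegral (h1.trans_le h12).ne']
  congr 1
  refine Complex.circleIntegral_sub_center_inv_smul_eq_of_differentiable_on_annulus_off_countable
    h1 h12 Set.countable_empty (fun w hw => ?_) (fun w hw => ?_)
  · have : ρ₁ ≤ ‖w‖ := by simpa using hw.2
    exact (differentiableAt_smul_sqrtOneAdd hh h1 this hM).continuousAt.continuousWithinAt
  · have : ρ₁ < ‖w‖ := by simpa using hw.1.2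
    exact differentiableAt_smul_sqrtOneAdd hh h1 this.le hM

/-- The holomorphic function of `M` that takes the value `h A` when `M` is "`A` squared". -/
noncomputable def sqrtDescent (h : Matrix m m ℂ → ℂ) (M : Matrix m m ℂ) : ℂ :=
  sqrtAverage h (2 * ((Fintype.card m + 1) * ‖M‖) + 1) M

/-- The radius in `sqrtDescent` varies with `‖M‖`, which spoils holomorphy at first sight. A common
radius may be used on each ball, because `x ≤ (x + 1)²` makes the radius admissible. -/
theorem sqrtDescent_eq {h : Matrix m m ℂ → ℂ} (hh : Differentiable ℂ h) {R : ℝ}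
    {M : Matrix m m ℂ} (hM : ‖M‖ ≤ R) :
    sqrtDescent h M = sqrtAverage h (2 * ((Fintype.card m + 1) * R) + 1) M := by
  have : 0 ≤ 2 * ((Fintype.card m + 1) * ‖M‖) := by positivity
  refine (sqrtAverage_radius hh (by positivity) (by gcongr) ?_).symm
  nlinarith

theorem differentiable_sqrtDescent {h : Matrix m m ℂ → ℂ} (hh : Differentiable ℂ h) :
    Differentiable ℂ (sqrtDescent h) := by
  intro M₀
  set R : ℝ := ‖M₀‖ + 1 with hR
  set ρ : ℝ := 2 * ((Fintype.card m + 1) * R) + 1 with hρ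
  have hρ0 : 0 < ρ := by positivity
  have hball : ∀ M ∈ Metric.ball M₀ 1, ‖M‖ ≤ R := fun M hM => by
    have h1 := norm_le_norm_add_norm_sub' M M₀
    have h2 : ‖M - M₀‖ < 1 := by rwa [Metric.mem_ball, dist_eq_norm] at hM
    linarith
  have hsmall : ∀ M ∈ Metric.ball M₀ 1, 2 * ((Fintype.card m + 1) * ‖M‖) ≤ ρ ^ 2 := by
    intro M hM
    have h1 : 2 * ((Fintype.card m + 1) * ‖M‖) ≤ 2 * ((Fintype.card m + 1) * R) := by
      have := hball M hM
      gcongr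
    have h2 : 0 ≤ 2 * ((Fintype.card m + 1) * R) := by positivity
    nlinarith
  have hw : ∀ θ, ‖circleMap 0 ρ θ‖ = ρ := fun θ => by simp [abs_of_pos hρ0]
  obtain ⟨C, hC⟩ := (isCompact_closedBall (0 : Matrix m m ℂ)
    (ρ * sqrtBound)).exists_bound_of_continuousOn hh.continuous.continuousOn
  have key : DifferentiableAt ℂ (sqrtAverage h ρ) M₀ := by
    refine differentiableAt_circleAverage (C := C) (r := 1) one_pos (fun M hM => ?_)
      (fun θ M hM => ?_) (fun θ M hM => hC _ ?_)
    · refine continuous_iff_continuousAt.2 fun θ => ?_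
      exact ContinuousAt.comp
        (f := circleMap 0 ρ) (g := fun w => h (w • sqrtOneAdd ((w ^ 2)⁻¹ • M)))
        (differentiableAt_smul_sqrtOneAdd hh hρ0 (hw θ).ge (hsmall M hM)).continuousAt
        (continuous_circleMap 0 ρ).continuousAt
    · refine DifferentiableAt.differentiableWithinAt ?_
      have h1 := card_mul_norm_inv_sq_smul_le hρ0 (hw θ).ge (hsmall M hM)
      have h2 : DifferentiableAt ℂ (fun M : Matrix m m ℂ => ((circleMap 0 ρ θ) ^ 2)⁻¹ • M) M :=
        differentiableAt_id.fun_const_smul _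
      have h3 := DifferentiableAt.comp M
        (differentiableAt_sqrtOneAdd (lt_of_le_of_lt h1 (by norm_num))) h2
      exact (hh _).comp M (h3.const_smul (circleMap 0 ρ θ))
    · rw [mem_closedBall_zero_iff, norm_smul, hw]
      gcongr
      exact norm_sqrtOneAdd_le (card_mul_norm_inv_sq_smul_le hρ0 (hw θ).ge (hsmall M hM))
  refine key.congr_of_eventuallyEq ?_
  filter_upwards [Metric.ball_mem_nhds M₀ one_pos] with M hM
  exact sqrtDescent_eq hh (hball M hM)

/-- The radius grows linearly in `‖M‖`, so a bound `(c‖A‖)^d` on `h` becomes one of the form `S^d`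
with `S` independent of `d`. This makes the final series converge. -/
theorem norm_sqrtDescent_le {h : Matrix m m ℂ → ℂ} {M : Matrix m m ℂ} {C : ℝ}
    (hC : ∀ A, ‖A‖ ≤ (2 * ((Fintype.card m + 1) * ‖M‖) + 1) * sqrtBound → ‖h A‖ ≤ C) :
    ‖sqrtDescent h M‖ ≤ C := by
  have h0 : 0 ≤ 2 * ((Fintype.card m + 1) * ‖M‖) := by positivity
  refine norm_circleAverage_le fun θ => hC _ ?_
  rw [norm_smul]
  have hw : ‖circleMap 0 (2 * ((Fintype.card m + 1) * ‖M‖) + 1) θ‖ =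
      2 * ((Fintype.card m + 1) * ‖M‖) + 1 := by
    simp [abs_of_pos (show 0 < 2 * ((Fintype.card m + 1) * ‖M‖) + 1 by positivity)]
  rw [hw]
  gcongr
  exact norm_sqrtOneAdd_le (card_mul_norm_inv_sq_smul_le
    (show 0 < 2 * ((Fintype.card m + 1) * ‖M‖) + 1 by positivity) hw.ge (by nlinarith))

theorem cpow_half_sq (z : ℂ) : (z ^ (1 / 2 : ℂ)) ^ 2 = z := by
  simp

/-- A branch adapted to `ζ₀`: at the branch point the principal root is continuous, and elsewhere
rescaling by `ζ₀ + l` moves the argument to `1`, away from the cut. -/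
theorem exists_sqrt_branch (l ζ₀ : ℂ) : ∃ b : ℂ → ℂ, (∀ ζ, b ζ ^ 2 = ζ + l) ∧
    ContinuousAt b ζ₀ ∧ (ζ₀ + l ≠ 0 → DifferentiableAt ℂ b ζ₀) := by
  by_cases h : ζ₀ + l = 0
  · refine ⟨fun ζ => (ζ + l) ^ (1 / 2 : ℂ), fun ζ => cpow_half_sq _, ?_, fun h' => absurd h h'⟩
    have h1 : ContinuousAt (fun x : ℂ => x ^ (1 / 2 : ℂ)) (ζ₀ + l) := by
      rw [h]
      exact Complex.continuousAt_cpow_const_of_re_pos (Or.inl le_rfl) (by norm_num)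
    exact ContinuousAt.comp (f := fun ζ : ℂ => ζ + l) h1 (by fun_prop)
  · have hd : DifferentiableAt ℂ (fun ζ => (ζ₀ + l) ^ (1 / 2 : ℂ) *
        ((ζ + l) / (ζ₀ + l)) ^ (1 / 2 : ℂ)) ζ₀ := by
      refine DifferentiableAt.const_mul ?_ _
      refine DifferentiableAt.cpow (by fun_prop) (by fun_prop) ?_
      rw [div_self h]
      exact Complex.one_mem_slitPlane
    refine ⟨_, fun ζ => ?_, hd.continuousAt, fun _ => hd⟩
    rw [mul_pow, cpow_half_sq, cpow_half_sq, mul_div_cancel₀ _ h]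

/-- By evenness, `h(√(M + ζ))` does not depend on the choice of roots. Local branches make it
continuous everywhere and holomorphic off finitely many points, so the mean value property applies.
-/
theorem sqrtDescent_sum_smul_idempotent {h : Matrix m m ℂ → ℂ} (hh : Differentiable ℂ h)
    {ι : Type*} [Fintype ι] [DecidableEq ι]
    {e : ι → Matrix m m ℂ} (he : ∀ i j, e i * e j = if i = j then e i else 0)
    (hs : ∑ i, e i = 1)
    (heven : ∀ y y' : ι → ℂ, (∀ i, y i ^ 2 = y' i ^ 2) → h (∑ i, y i • e i) = h (∑ i, y' i • e i))
    (y : ι → ℂ) : sqrtDescent h (∑ i, y i ^ 2 • e i) = h (∑ i, y i • e i) := by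
  set M := ∑ i, y i ^ 2 • e i with hM
  -- The second summand ensures `|w⁻² y_i²| < 1` on the circle, so that the scalar series for the
  -- roots converge too.
  set R : ℝ := ‖M‖ + ∑ i, ‖y i ^ 2‖ with hR
  have hR0 : 0 ≤ R := by positivity
  set ρ : ℝ := 2 * ((Fintype.card m + 1) * R) + 1 with hρ
  have hρ0 : 0 < ρ := by positivity
  have hρ1 : R < ρ ^ 2 := by
    have h0 : 0 ≤ 2 * (Fintype.card m * R) := by positivity
    nlinarith
  have hyρ : ∀ i, ‖y i ^ 2‖ < ρ ^ 2 := fun i => by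
    have := Finset.single_le_sum (f := fun i => ‖y i ^ 2‖) (fun i _ => norm_nonneg _)
      (Finset.mem_univ i)
    have h2 := norm_nonneg M
    linarith
  set G : ℂ → ℂ := fun ζ => h (∑ i, (ζ + y i ^ 2) ^ (1 / 2 : ℂ) • e i) with hG
  have hG' : ∀ ζ (s : ι → ℂ), (∀ i, s i ^ 2 = ζ + y i ^ 2) → G ζ = h (∑ i, s i • e i) :=
    fun ζ s hs => heven _ _ fun i => by rw [cpow_half_sq, hs]
  have hbranch : ∀ ζ₀, ∃ b : ℂ → ι → ℂ, (∀ ζ i, b ζ i ^ 2 = ζ + y i ^ 2) ∧ ContinuousAt b ζ₀ ∧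
      ((∀ i, ζ₀ + y i ^ 2 ≠ 0) → DifferentiableAt ℂ b ζ₀) := by
    intro ζ₀
    choose b hb1 hb2 hb3 using fun i => exists_sqrt_branch (y i ^ 2) ζ₀
    exact ⟨fun ζ i => b i ζ, fun ζ i => hb1 i ζ, continuousAt_pi.2 hb2,
      fun hne => differentiableAt_pi.2 fun i => hb3 i (hne i)⟩
  have hlin : Differentiable ℂ fun s : ι → ℂ => h (∑ i, s i • e i) := by
    refine hh.comp (Differentiable.fun_sum fun i _ => ?_)
    exact (differentiable_apply i).smul_const _
  have hGc : Continuous G := by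
    refine continuous_iff_continuousAt.2 fun ζ₀ => ?_
    obtain ⟨b, hb1, hb2, -⟩ := hbranch ζ₀
    have : G = fun ζ => h (∑ i, b ζ i • e i) := funext fun ζ => hG' ζ _ (hb1 ζ)
    rw [this]
    exact ContinuousAt.comp (f := b) hlin.continuous.continuousAt hb2
  have hGd : ∀ ζ₀, (∀ i, ζ₀ + y i ^ 2 ≠ 0) → DifferentiableAt ℂ G ζ₀ := by
    intro ζ₀ hne
    obtain ⟨b, hb1, -, hb3⟩ := hbranch ζ₀
    have : G = fun ζ => h (∑ i, b ζ i • e i) := funext fun ζ => hG' ζ _ (hb1 ζ)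
    rw [this]
    exact DifferentiableAt.comp (f := b) ζ₀ (hlin _) (hb3 hne)
  rw [sqrtDescent_eq hh (R := R) (le_add_of_nonneg_right (by positivity)), sqrtAverage]
  have hcongr : Real.circleAverage (fun w => h (w • sqrtOneAdd ((w ^ 2)⁻¹ • M))) 0 ρ =
      Real.circleAverage (fun w => G (w ^ 2)) 0 ρ := by
    refine Real.circleAverage_congr_sphere fun w hw => ?_
    have hw' : ‖w‖ = ρ := by simpa [abs_of_pos hρ0] using hw
    have hw0 : w ≠ 0 := norm_pos_iff.1 (hw' ▸ hρ0)
    have h1 : (w ^ 2)⁻¹ • M = ∑ i, ((w ^ 2)⁻¹ * y i ^ 2) • e i := by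
      rw [hM, Finset.smul_sum]
      simp only [smul_smul]
    rw [h1, sqrtOneAdd_sum_smul_idempotent he hs (fun i => ?_), Finset.smul_sum]
    · simp only [smul_smul]
      refine (hG' _ _ fun i => ?_).symm
      rw [mul_pow, cpow_half_sq]
      field_simp
    · rw [norm_mul, norm_inv, norm_pow w, hw', inv_mul_lt_iff₀ (by positivity), mul_one]
      exact hyρ i
  -- The exceptional points `w = ±i y_i` are those where some `w² + y_i²` vanishes.
  rw [hcongr, circleAverage_of_differentiable_on_off_countable
    (s := Set.range (fun i => Complex.I * y i) ∪ Set.range (fun i => -(Complex.I * y i)))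
    ((Set.countable_range _).union (Set.countable_range _))
    (show Continuous fun w => G (w ^ 2) from hGc.comp (continuous_pow 2)).continuousOn]
  · exact hG' _ _ fun i => by simp
  · intro w hw
    refine DifferentiableAt.comp (g := G) w (hGd _ fun i hi => hw.2 ?_) (by fun_prop)
    have h1 : w ^ 2 = (Complex.I * y i) ^ 2 := by
      rw [mul_pow, Complex.I_sq]
      linear_combination hi
    rcases sq_eq_sq_iff_eq_or_eq_neg.1 h1 with h2 | h2
    · exact Or.inl ⟨i, h2.symm⟩
    · exact Or.inr ⟨i, h2.symm⟩

end

/-! ### Polar decomposition inside a real `*`-algebra -/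

section
variable {m : Type} [Fintype m] [DecidableEq m]

/-- Real functions of a Hermitian matrix are real polynomials in it. -/
theorem exists_aeval_eq_conj_diagonal {M : Matrix m m ℂ} (hM : M.IsHermitian) (φ : ℝ → ℝ) :
    ∃ q : Polynomial ℝ, Polynomial.aeval M q = Unitary.conjStarAlgAut ℂ _ hM.eigenvectorUnitary
      (diagonal fun i => ((φ (hM.eigenvalues i) : ℝ) : ℂ)) := by
  refine ⟨Lagrange.interpolate (Finset.univ.image hM.eigenvalues) id φ, ?_⟩
  set q := Lagrange.interpolate (Finset.univ.image hM.eigenvalues) id φ with hq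
  have hqe : ∀ i, q.eval (hM.eigenvalues i) = φ (hM.eigenvalues i) := fun i =>
    Lagrange.eval_interpolate_at_node φ Function.injective_id.injOn
      (Finset.mem_image_of_mem _ (Finset.mem_univ i))
  let Φ : Matrix m m ℂ →ₐ[ℝ] Matrix m m ℂ :=
    ((Unitary.conjStarAlgAut ℂ (Matrix m m ℂ) hM.eigenvectorUnitary).toAlgEquiv.toAlgHom :
      Matrix m m ℂ →ₐ[ℂ] Matrix m m ℂ).restrictScalars ℝ
  have h1 : M = Φ (diagonalAlgHom ℝ fun i => (hM.eigenvalues i : ℂ)) := hM.spectral_theorem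
  conv_lhs => rw [h1]
  rw [Polynomial.aeval_algHom_apply, Polynomial.aeval_algHom_apply]
  change Φ _ = Φ _
  congr 1
  rw [diagonalAlgHom_apply]
  congr 1
  funext i
  have h2 : (Polynomial.aeval (fun i => (hM.eigenvalues i : ℂ)) q) i =
      Polynomial.aeval (hM.eigenvalues i : ℂ) q :=
    (Polynomial.aeval_algHom_apply (Pi.evalAlgHom ℝ (fun _ : m => ℂ) i) _ q).symm
  rw [h2, ← hqe]
  exact (Polynomial.aeval_algebraMap_apply ℂ (hM.eigenvalues i) q)

theorem aeval_mem_of_mem {R : Subalgebra ℝ (Matrix m m ℂ)} {A : Matrix m m ℂ} (hA : A ∈ R)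
    (q : Polynomial ℝ) : Polynomial.aeval A q ∈ R := by
  have := Polynomial.aeval_algHom_apply R.val (⟨A, hA⟩ : R) q
  rw [Subalgebra.val_apply] at this
  rw [this]
  exact Subtype.property _

open scoped ComplexOrder in
/-- Spectral resolution of a positive definite matrix, with spectral projections that are real
polynomials in the matrix. -/
theorem exists_spectral_resolution {M : Matrix m m ℂ} (hM : M.PosDef) :
    ∃ (ι : Type) (_ : Fintype ι) (_ : DecidableEq ι) (l : ι → ℝ) (e : ι → Matrix m m ℂ)
      (q : ι → Polynomial ℝ), (∀ i, 0 < l i) ∧ (∀ i, e i = Polynomial.aeval M (q i)) ∧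
      (∀ i j, e i * e j = if i = j then e i else 0) ∧ ∑ i, e i = 1 ∧ (∀ i, (e i)ᴴ = e i) ∧
      M = ∑ i, ((l i : ℝ) : ℂ) • e i := by
  classical
  have hH := hM.1
  set Φ := Unitary.conjStarAlgAut ℂ (Matrix m m ℂ) hH.eigenvectorUnitary with hΦ
  -- Indexing by distinct eigenvalues, without multiplicity, is what makes each spectral projection
  -- a polynomial in `M`.
  set s := Finset.univ.image hH.eigenvalues with hs
  choose q hq using fun x : s =>
    exists_aeval_eq_conj_diagonal hH fun y => if y = (x : ℝ) then 1 else 0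
  have hd : ∀ c : ℝ → ℂ, ∑ x : s, c x • diagonal
      (fun i => (((if hH.eigenvalues i = (x : ℝ) then 1 else 0 : ℝ)) : ℂ)) =
      diagonal fun i => c (hH.eigenvalues i) := by
    intro c
    ext i j
    rw [Matrix.sum_apply]
    by_cases hij : i = j
    · subst hij
      rw [Finset.sum_eq_single
        (⟨hH.eigenvalues i, Finset.mem_image_of_mem _ (Finset.mem_univ i)⟩ : s)]
      · simp
      · rintro ⟨x, hx⟩ - hne
        have : hH.eigenvalues i ≠ x := fun h => hne (Subtype.ext h.symm)
        simp [this]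
      · simp
    · simp [hij]
  refine ⟨s, inferInstance, inferInstance, fun x => x, fun x => Polynomial.aeval M (q x), q,
    ?_, fun _ => rfl, ?_, ?_, ?_, ?_⟩
  · rintro ⟨x, hx⟩
    obtain ⟨i, -, rfl⟩ := Finset.mem_image.1 hx
    exact hM.eigenvalues_pos i
  · intro x y
    simp only [hq]
    rw [ ← map_mul, diagonal_mul_diagonal]
    split_ifs with h
    · subst h
      congr 2
      funext i
      split_ifs <;> simp
    · rw [← map_zero Φ, ← diagonal_zero]
      congr 2
      funext i
      split_ifs with h1 h2 <;> simp
      exact h (Subtype.ext (h1.symm.trans h2))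
  · simp only [hq]
    rw [← map_sum, ← map_one Φ, ← diagonal_one]
    simpa only [one_smul] using congrArg Φ (hd fun _ => 1)
  · intro x
    simp only [hq]
    change star (Φ _) = _
    rw [← map_star, star_eq_conjTranspose, diagonal_conjTranspose]
    congr 2
    funext i
    simp
  · simp only [hq]
    simp only [← map_smul]
    rw [← map_sum, hd fun x => (x : ℂ)]
    exact hH.spectral_theorem

/-- Identity theorem with accumulation point `T + 1`. It serves both to remove invertibility
assumptions and to pass from real to complex parameters. -/
theorem eq_zero_of_eq_zero_on_ray {ψ : ℂ → ℂ} (hψ : Differentiable ℂ ψ) {T : ℝ}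
    (h : ∀ t : ℝ, T < t → ψ t = 0) (z : ℂ) : ψ z = 0 := by
  have han : AnalyticOnNhd ℂ ψ Set.univ := hψ.differentiableOn.analyticOnNhd isOpen_univ
  refine han.eqOn_zero_of_preconnected_of_frequently_eq_zero isPreconnected_univ
    (Set.mem_univ ((T + 1 : ℝ) : ℂ)) ?_ (Set.mem_univ z)
  have ht : Filter.Tendsto (fun n : ℕ => ((T + 1 + 1 / ((n : ℝ) + 1) : ℝ) : ℂ)) Filter.atTop
      (nhdsWithin ((T + 1 : ℝ) : ℂ) {((T + 1 : ℝ) : ℂ)}ᶜ) := by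
    refine tendsto_nhdsWithin_iff.2 ⟨?_, Filter.Eventually.of_forall fun n => ?_⟩
    · refine (Complex.continuous_ofReal.tendsto _).comp ?_
      simpa using (tendsto_one_div_add_atTop_nhds_zero_nat (𝕜 := ℝ)).const_add (T + 1)
    · have : (1 : ℝ) / ((n : ℝ) + 1) ≠ 0 := by positivity
      simp only [Set.mem_compl_iff, Set.mem_singleton_iff, Complex.ofReal_inj]
      intro h
      exact this (by linarith)
  refine ht.frequently (Filter.Frequently.of_forall fun n => h _ ?_)
  have : (0 : ℝ) < 1 / ((n : ℝ) + 1) := by positivity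
  linarith

theorem exists_isUnit_det_add_smul_one (A : Matrix m m ℂ) :
    ∃ T : ℝ, ∀ t : ℝ, T < t → IsUnit (A + (t : ℂ) • (1 : Matrix m m ℂ)).det := by
  obtain ⟨T, hT⟩ := (((-A).charpoly.roots.toFinset.finite_toSet).image Complex.re).bddAbove
  refine ⟨T, fun t ht => isUnit_iff_ne_zero.2 fun h0 => ?_⟩
  have hroot : (-A).charpoly.eval (t : ℂ) = 0 := by
    rw [Matrix.eval_charpoly, ← h0]
    congr 1
    rw [sub_neg_eq_add, add_comm, smul_one_eq_diagonal]
    rfl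
  have := hT ⟨t, by simpa using ⟨(-A).charpoly_monic.ne_zero, hroot⟩, rfl⟩
  simp at this
  linarith

-- Polar decomposition: the spectral projections of `a*a` are real polynomials in it, hence lie in
-- `R`. So do the sign matrices `∑ ±e_i` and the unitary polar factor, and `h` is invariant under
-- both.
open scoped ComplexOrder in
theorem sqrtDescent_conjTranspose_mul_self {R : Subalgebra ℝ (Matrix m m ℂ)}
    (hstar : ∀ A ∈ R, Aᴴ ∈ R) {h : Matrix m m ℂ → ℂ} (hh : Differentiable ℂ h)
    (hinv : ∀ k ∈ R, kᴴ * k = 1 → ∀ A, h (k * A) = h A)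
    {a : Matrix m m ℂ} (ha : a ∈ R) (hdet : IsUnit a.det) :
    sqrtDescent h (aᴴ * a) = h a := by
  have hpos : (aᴴ * a).PosDef := Matrix.PosDef.conjTranspose_mul_self a
    (Matrix.mulVec_injective_of_isUnit ((Matrix.isUnit_iff_isUnit_det a).2 hdet))
  obtain ⟨ι, _, _, l, e, q, hl, heq, he, hsum, hadj, hM⟩ := exists_spectral_resolution hpos
  have heR : ∀ i, e i ∈ R := fun i => by
    rw [heq]
    exact aeval_mem_of_mem (mul_mem (hstar a ha) ha) _
  have hmemR : ∀ y : ι → ℝ, ∑ i, ((y i : ℝ) : ℂ) • e i ∈ R := fun y =>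
    sum_mem fun i _ => R.smul_mem (heR i) (y i)
  have hmul : ∀ y y' : ι → ℂ, (∑ i, y i • e i) * (∑ i, y' i • e i) = ∑ i, (y i * y' i) • e i := by
    intro y y'
    rw [Finset.sum_mul]
    refine Finset.sum_congr rfl fun i _ => ?_
    rw [Finset.mul_sum, Finset.sum_eq_single i]
    · simp [he, smul_smul, mul_comm]
    · intro j _ hj
      simp [he, hj.symm]
    · simp
  have hconj : ∀ y : ι → ℝ, (∑ i, ((y i : ℝ) : ℂ) • e i)ᴴ = ∑ i, ((y i : ℝ) : ℂ) • e i := by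
    intro y
    simp [conjTranspose_sum, conjTranspose_smul, hadj]
  have heven : ∀ y y' : ι → ℂ, (∀ i, y i ^ 2 = y' i ^ 2) →
      h (∑ i, y i • e i) = h (∑ i, y' i • e i) := by
    intro y y' hyy
    choose s hs1 hs2 using fun i => show ∃ s : ℝ, s * s = 1 ∧ y i = s * y' i by
      rcases sq_eq_sq_iff_eq_or_eq_neg.1 (hyy i) with h | h
      · exact ⟨1, by simp, by simp [h]⟩
      · exact ⟨-1, by simp, by simp [h]⟩
    have h1 := hinv _ (hmemR s) (by
      rw [hconj, hmul]
      simp only [← Complex.ofReal_mul, hs1]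
      simpa using hsum) (∑ i, y' i • e i)
    rw [← h1, hmul]
    simp only [hs2]
  have hsq : aᴴ * a = ∑ i, ((√(l i) : ℝ) : ℂ) ^ 2 • e i := by
    refine hM.trans (Finset.sum_congr rfl fun i _ => ?_)
    rw [← Complex.ofReal_pow, Real.sq_sqrt (hl i).le]
  rw [hsq, sqrtDescent_sum_smul_idempotent hh he hsum heven]
  have hl0 : ∀ i, ((√(l i) : ℝ) : ℂ) ≠ 0 := fun i =>
    Complex.ofReal_ne_zero.2 (Real.sqrt_pos.2 (hl i)).ne'
  have hinvR := hmemR fun i => (√(l i))⁻¹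
  -- The polar factor `a (a*a)^{-1/2}` is applied to `(a*a)^{1/2}`.
  have h2 := hinv _ (mul_mem ha hinvR) (by
    rw [conjTranspose_mul, hconj, Matrix.mul_assoc, ← Matrix.mul_assoc aᴴ, hsq, hmul, hmul, ← hsum]
    refine Finset.sum_congr rfl fun i _ => ?_
    have := hl0 i
    push_cast
    rw [show ((√(l i) : ℝ) : ℂ)⁻¹ * (((√(l i) : ℝ) : ℂ) ^ 2 * ((√(l i) : ℝ) : ℂ)⁻¹) = 1 by
      field_simp, one_smul]) (∑ i, ((√(l i) : ℝ) : ℂ) • e i)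
  have h3 : ∑ i, ((((√(l i))⁻¹ : ℝ) : ℂ) * ((√(l i) : ℝ) : ℂ)) • e i = 1 := by
    rw [← hsum]
    refine Finset.sum_congr rfl fun i _ => ?_
    rw [Complex.ofReal_inv, inv_mul_cancel₀ (hl0 i), one_smul]
  rw [← h2, Matrix.mul_assoc, hmul, h3, Matrix.mul_one]

/-- The descent of a function invariant under the unitary elements of a real `*`-algebra `R` of
matrices: if `A ↦ β⁻¹ Aᵗ β` extends the conjugate transpose of `R`, then `h A` is a holomorphic
function of `β⁻¹ Aᵗ β A` for `A ∈ R + i R`. -/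
theorem sqrtDescent_transpose_mul_self {R : Subalgebra ℝ (Matrix m m ℂ)}
    (hstar : ∀ A ∈ R, Aᴴ ∈ R) {β β' : Matrix m m ℂ} (hβ : ∀ A ∈ R, Aᴴ = β' * Aᵀ * β)
    {h : Matrix m m ℂ → ℂ} (hh : Differentiable ℂ h)
    (hinv : ∀ k ∈ R, kᴴ * k = 1 → ∀ A, h (k * A) = h A)
    {a b : Matrix m m ℂ} (ha : a ∈ R) (hb : b ∈ R) :
    sqrtDescent h (β' * (a + Complex.I • b)ᵀ * β * (a + Complex.I • b)) =
      h (a + Complex.I • b) := by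
  -- The transpose, unlike the conjugate transpose, makes this difference holomorphic in `A`.
  set φ : Matrix m m ℂ → ℂ := fun A => sqrtDescent h (β' * Aᵀ * β * A) - h A with hφ
  have hφd : Differentiable ℂ φ := by
    refine Differentiable.sub ((differentiable_sqrtDescent hh).comp ?_) hh
    exact differentiable_matrix_mul (differentiable_matrix_mul (differentiable_matrix_mul
      (differentiable_const _) (differentiable_matrix_transpose differentiable_id))
      (differentiable_const _)) differentiable_id
  have hline : ∀ A B : Matrix m m ℂ, Differentiable ℂ fun t : ℂ => φ (A + t • B) := fun A B =>
    hφd.comp ((differentiable_const A).add (differentiable_id.smul_const B))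
  -- A singular `A` is reached from the invertible matrices `A + t`, `t` real and large.
  have h0 : ∀ A ∈ R, φ A = 0 := by
    intro A hA
    obtain ⟨T, hT⟩ := exists_isUnit_det_add_smul_one A
    have := eq_zero_of_eq_zero_on_ray (hline A 1) (T := T) (fun t ht => ?_) 0
    · simpa using this
    · have hmem : A + (t : ℂ) • (1 : Matrix m m ℂ) ∈ R :=
        add_mem hA (R.smul_mem (one_mem R) t)
      have := sqrtDescent_conjTranspose_mul_self hstar hh hinv hmem (hT t ht)
      rw [hβ _ hmem] at this
      simp only [hφ, this, sub_self]
  -- `φ(a + t b)` vanishes for real `t`, hence also at `t = i`.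
  have := eq_zero_of_eq_zero_on_ray (hline a b) (T := 0)
    (fun t _ => h0 _ (add_mem ha (R.smul_mem hb t))) Complex.I
  exact sub_eq_zero.1 this
end

/-! ### Averaging over the compact group and the Gram matrix -/

section
variable {m : Type} [Fintype m] [DecidableEq m]

theorem norm_le_one_of_conjTranspose_mul_self {k : Matrix m m ℂ} (hk : kᴴ * k = 1) : ‖k‖ ≤ 1 :=
  (Matrix.norm_le_iff zero_le_one).2 fun i j =>
    entry_norm_bound_of_unitary (mem_unitaryGroup_iff'.2 hk) i j

/-- The unitary elements of a real `*`-algebra of matrices carry an invariant probability measure. -/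
theorem exists_invariant_measure {R : Subalgebra ℝ (Matrix m m ℂ)} (hstar : ∀ A ∈ R, Aᴴ ∈ R) :
    ∃ (Ω : Type) (_ : MeasurableSpace Ω) (μ : MeasureTheory.Measure Ω) (κ : Ω → Matrix m m ℂ),
      MeasureTheory.IsProbabilityMeasure μ ∧
      (∀ g : Matrix m m ℂ → ℂ, Continuous g →
        MeasureTheory.AEStronglyMeasurable (fun ω => g (κ ω)) μ) ∧
      (∀ ω, κ ω ∈ R ∧ (κ ω)ᴴ * κ ω = 1) ∧
      ∀ k ∈ R, kᴴ * k = 1 → ∀ g : Matrix m m ℂ → ℂ, ∫ ω, g (κ ω * k) ∂μ = ∫ ω, g (κ ω) ∂μ := by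
  let K : Subgroup (unitaryGroup m ℂ) :=
    { carrier := {u | (u : Matrix m m ℂ) ∈ R}
      one_mem' := one_mem R
      mul_mem' := fun ha hb => mul_mem (S := Subalgebra ℝ (Matrix m m ℂ)) ha hb
      inv_mem' := fun ha => hstar _ ha }
  have hRc : IsClosed (R : Set (Matrix m m ℂ)) :=
    Submodule.closed_of_finiteDimensional (Subalgebra.toSubmodule R)
  have hK : IsClosed (K : Set (unitaryGroup m ℂ)) := hRc.preimage continuous_subtype_val
  have hU : IsClosed (unitaryGroup m ℂ : Set (Matrix m m ℂ)) := isClosed_unitary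
  have hemb : Topology.IsClosedEmbedding fun u : K => ((u : unitaryGroup m ℂ) : Matrix m m ℂ) :=
    hU.isClosedEmbedding_subtypeVal.comp hK.isClosedEmbedding_subtypeVal
  have hprop : ∀ u : K, ((u : unitaryGroup m ℂ) : Matrix m m ℂ)ᴴ *
      ((u : unitaryGroup m ℂ) : Matrix m m ℂ) = 1 := fun u =>
    UnitaryGroup.star_mul_self (u : unitaryGroup m ℂ)
  have hcomp : CompactSpace K := by
    refine ⟨?_⟩
    have := hemb.isCompact_preimage (isCompact_closedBall (0 : Matrix m m ℂ) 1)
    convert this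
    refine (Set.eq_univ_of_forall fun u => ?_).symm
    rw [Set.mem_preimage, mem_closedBall_zero_iff]
    exact norm_le_one_of_conjTranspose_mul_self (hprop u)
  let : MeasurableSpace K := borel K
  have : BorelSpace K := ⟨rfl⟩
  let μ : MeasureTheory.Measure K := MeasureTheory.Measure.haarMeasure ⊤
  have hμ : MeasureTheory.IsProbabilityMeasure μ := ⟨MeasureTheory.Measure.haarMeasure_self⟩
  -- Inversion turns the left invariance of Haar measure into right invariance: `u⁻¹ k = (k⁻¹ u)⁻¹`.
  refine ⟨K, inferInstance, μ, fun u => ((u⁻¹ : K) : unitaryGroup m ℂ), hμ, ?_, ?_, ?_⟩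
  · intro g hg
    refine Continuous.aestronglyMeasurable ?_
    exact hg.comp (continuous_subtype_val.comp (continuous_subtype_val.comp continuous_inv))
  · exact fun u => ⟨(u⁻¹ : K).2, hprop u⁻¹⟩
  · intro k hk hkk g
    let k' : K := ⟨⟨k, mem_unitaryGroup_iff'.2 hkk⟩, hk⟩
    have := MeasureTheory.integral_mul_left_eq_self (μ := μ)
      (fun u : K => g ((u⁻¹ : K) : unitaryGroup m ℂ)) k'⁻¹
    rw [← this]
    congr 1
    funext u
    rw [_root_.mul_inv_rev, inv_inv]
    rfl

theorem norm_trace_mul_le {k : Matrix m m ℂ} (hk : kᴴ * k = 1) (A : Matrix m m ℂ) :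
    ‖(k * A).trace‖ ≤ (Fintype.card m + 1) ^ 2 * ‖A‖ := by
  have h1 : ‖k * A‖ ≤ (Fintype.card m + 1) * ‖A‖ := by
    refine (norm_matrix_mul_le k A).trans ?_
    have := norm_le_one_of_conjTranspose_mul_self hk
    calc _ ≤ ((Fintype.card m : ℝ) + 1) * 1 * ‖A‖ := by gcongr
      _ = _ := by ring
  calc ‖(k * A).trace‖ ≤ ∑ _i : m, ‖k * A‖ :=
        norm_sum_le_of_le _ fun i _ => (k * A).norm_entry_le_entrywise_sup_norm
    _ = Fintype.card m * ‖k * A‖ := by simp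
    _ ≤ (Fintype.card m + 1) * ((Fintype.card m + 1) * ‖A‖) := by gcongr; simp
    _ = _ := by ring

omit [DecidableEq m] in
theorem differentiable_trace_mul_pow (k : Matrix m m ℂ) (d : ℕ) :
    Differentiable ℂ fun A : Matrix m m ℂ => (k * A).trace ^ d := by
  refine Differentiable.fun_pow ?_ d
  refine Differentiable.fun_sum fun i _ => ?_
  exact differentiable_matrix_iff.1 (differentiable_matrix_mul (differentiable_const k)
    differentiable_id) i i

/-- Holomorphic functions invariant under the unitary part of a real `*`-algebra of matrices, on a
representation `X` of it, are holomorphic functions of the Gram matrix. -/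
theorem exists_differentiable_gram {V : Type*} [NormedAddCommGroup V] [NormedSpace ℂ V]
    [FiniteDimensional ℂ V] {f : V → ℂ} (hf : Differentiable ℂ f)
    {R : Subalgebra ℝ (Matrix m m ℂ)} (hstar : ∀ A ∈ R, Aᴴ ∈ R)
    {β β' : Matrix m m ℂ} (hβ : ∀ A ∈ R, Aᴴ = β' * Aᵀ * β) {p : Type} [Fintype p]
    [DecidableEq p] (X : V →ₗ[ℂ] Matrix m p ℂ) (Y : (V →ₗ[ℂ] ℂ) →ₗ[ℂ] Matrix p m ℂ)
    (hXY : ∀ v l, l v = (X v * Y l).trace)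
    (hmem : ∀ v l, ∃ a ∈ R, ∃ b ∈ R, X v * Y l = a + Complex.I • b)
    (hinv : ∀ k ∈ R, kᴴ * k = 1 → ∀ v, ∃ v', X v' = k * X v ∧ f v' = f v) :
    ∃ F : Matrix p p ℂ → ℂ, Differentiable ℂ F ∧ ∀ v, F ((X v)ᵀ * β * X v) = f v := by
  obtain ⟨Ω, _, μ, κ, hμ, hmeas, hκ, hμinv⟩ := exists_invariant_measure hstar
  set bV := Module.finBasis ℂ V
  have hfb : Differentiable ℂ fun z => f (bV.equivFun.symm z) :=
    hf.comp (LinearMap.toContinuousLinearMap bV.equivFun.symm.toLinearMap).differentiable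
  obtain ⟨J, hJ, c, y, d, hy, hsum, hs⟩ := exists_hasSum_pow_linear_form hfb
  set l : J → V →ₗ[ℂ] ℂ := fun j => ∑ i, y j i • bV.coord i with hl
  have hfs : ∀ v, HasSum (fun j => c j * l j v ^ d j) (f v) := by
    intro v
    simpa [hl] using hs (bV.equivFun v)
  set D : ℝ := ∑ i, ‖Y (bV.coord i)‖ with hD
  have hD0 : 0 ≤ D := by positivity
  have hYD : ∀ j, ‖Y (l j)‖ ≤ D := by
    intro j
    simp only [hl, map_sum, map_smul]
    refine norm_sum_le_of_le _ fun i _ => ?_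
    rw [norm_smul]
    exact mul_le_of_le_one_left (norm_nonneg _) (hy j i)
  set h : ℕ → Matrix m m ℂ → ℂ := fun d A => ∫ ω, (κ ω * A).trace ^ d ∂μ with hh
  have hpt : ∀ d A ω, ‖(κ ω * A).trace ^ d‖ ≤ ((Fintype.card m + 1) ^ 2 * ‖A‖) ^ d := by
    intro d A ω
    rw [norm_pow]
    exact pow_le_pow_left₀ (norm_nonneg _) (norm_trace_mul_le (hκ ω).2 A) d
  have hms : ∀ d A, MeasureTheory.AEStronglyMeasurable (fun ω => (κ ω * A).trace ^ d) μ := by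
    intro d A
    refine hmeas (fun k => (k * A).trace ^ d) ?_
    fun_prop
  have hhd : ∀ d, Differentiable ℂ (h d) := by
    intro d A
    refine differentiableAt_integral_of_dominated one_pos (fun B _ => hms d B)
      (fun ω => (differentiable_trace_mul_pow (κ ω) d).differentiableOn)
      (MeasureTheory.integrable_const (((Fintype.card m + 1) ^ 2 * (‖A‖ + 1)) ^ d))
      fun ω B hB => (hpt d B ω).trans ?_
    have h1 := norm_le_norm_add_norm_sub' B A
    have h2 : ‖B - A‖ < 1 := by rwa [Metric.mem_ball, dist_eq_norm] at hB
    gcongr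
    linarith
  have hhb : ∀ d A, ‖h d A‖ ≤ ((Fintype.card m + 1) ^ 2 * ‖A‖) ^ d := by
    intro d A
    have := MeasureTheory.norm_integral_le_of_norm_le_const (μ := μ)
      (Filter.Eventually.of_forall (hpt d A))
    simpa using this
  -- Right invariance of the measure becomes left invariance of `h d`.
  have hhinv : ∀ d, ∀ k ∈ R, kᴴ * k = 1 → ∀ A, h d (k * A) = h d A := by
    intro d k hk hkk A
    have := hμinv k hk hkk fun B => (B * A).trace ^ d
    simpa only [hh, Matrix.mul_assoc] using this
  -- For `A = X Y_j` one has `β' Aᵗ β A = β' Y_jᵗ (Xᵗ β X) Y_j`; the Gram matrix is replaced by a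
  -- free variable `M`.
  refine ⟨fun M => ∑' j, c j * sqrtDescent (h (d j)) (β' * (Y (l j))ᵀ * M * Y (l j)), ?_, ?_⟩
  · intro M₀
    -- `P` bounds the argument of the descent for all `j` and all `M` near `M₀`; the `d`-th root of
    -- the bound on `h d` there is at most `S`.
    set P : ℝ := (Fintype.card p + 1) * ((Fintype.card p + 1) * ((Fintype.card m + 1) * ‖β'‖ * D)
      * (‖M₀‖ + 1)) * D with hP
    set S : ℝ := (Fintype.card m + 1) ^ 2 *
      ((2 * ((Fintype.card m + 1) * P) + 1) * sqrtBound) + 1 with hS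
    have hS0 : 0 < S := by have := sqrtBound_nonneg; positivity
    refine differentiableAt_tsum_of_dominated (r := 1) (fun j => ?_) one_pos (hsum S hS0) ?_
    · refine Differentiable.const_mul ((differentiable_sqrtDescent (hhd _)).comp ?_) _
      exact differentiable_matrix_mul (differentiable_matrix_mul (differentiable_const _)
        differentiable_id) (differentiable_const _)
    · intro j M hM
      have hM' : ‖M‖ ≤ ‖M₀‖ + 1 := by
        have h1 := norm_le_norm_add_norm_sub' M M₀
        have h2 : ‖M - M₀‖ < 1 := by rwa [Metric.mem_ball, dist_eq_norm] at hM
        linarith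
      rw [norm_mul]
      gcongr
      have hYt : ‖(Y (l j))ᵀ‖ ≤ D := (Matrix.norm_transpose _).trans_le (hYD j)
      have hN : ‖β' * (Y (l j))ᵀ * M * Y (l j)‖ ≤ P := by
        refine (norm_matrix_mul_le _ _).trans ?_
        have h1 := norm_matrix_mul_le (β' * (Y (l j))ᵀ) M
        have h2 := norm_matrix_mul_le β' (Y (l j))ᵀ
        have := hYD j
        have h3 : ‖β' * (Y (l j))ᵀ * M‖ ≤ (Fintype.card p + 1) *
            ((Fintype.card m + 1) * ‖β'‖ * D) * (‖M₀‖ + 1) := by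
          refine h1.trans ?_
          gcongr
          refine h2.trans ?_
          gcongr
        rw [hP]
        gcongr
      refine norm_sqrtDescent_le fun A hA => (hhb _ A).trans ?_
      have h4 : ‖A‖ ≤ (2 * ((Fintype.card m + 1) * P) + 1) * sqrtBound := by
        refine hA.trans ?_
        have := sqrtBound_nonneg
        gcongr
      refine pow_le_pow_left₀ (by positivity) ?_ _
      have h5 : ((Fintype.card m : ℝ) + 1) ^ 2 * ‖A‖ ≤ (Fintype.card m + 1) ^ 2 *
        ((2 * ((Fintype.card m + 1) * P) + 1) * sqrtBound) := by gcongr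
      linarith
  · intro v
    set A : J → Matrix m m ℂ := fun j => X v * Y (l j) with hA
    have hterm : ∀ j, sqrtDescent (h (d j)) (β' * (Y (l j))ᵀ * ((X v)ᵀ * β * X v) * Y (l j)) =
        h (d j) (A j) := by
      intro j
      obtain ⟨a, ha, b, hb, hab⟩ := hmem v (l j)
      have := sqrtDescent_transpose_mul_self hstar hβ (hhd (d j)) (hhinv (d j)) ha hb
      rw [← hab, transpose_mul] at this
      rw [← this]
      congr 1
      simp only [Matrix.mul_assoc]
    simp only [hterm]
    -- For each `κ ω` the series sums to `f` at the translated vector, which is `f v`. Integrating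
    -- termwise then gives the claim.
    have hω : ∀ ω, ∑' j, c j * (κ ω * A j).trace ^ d j = f v := by
      intro ω
      obtain ⟨v', hv', hfv⟩ := hinv (κ ω) (hκ ω).1 (hκ ω).2 v
      rw [← hfv, ← (hfs v').tsum_eq]
      refine tsum_congr fun j => ?_
      rw [hXY v', hv', Matrix.mul_assoc]
    set S : ℝ := (Fintype.card m + 1) ^ 2 * ((Fintype.card p + 1) * ‖X v‖ * D) + 1 with hS
    have hS0 : 0 < S := by positivity
    have hbd : ∀ j ω, ‖c j * (κ ω * A j).trace ^ d j‖ ≤ ‖c j‖ * S ^ d j := by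
      intro j ω
      rw [norm_mul]
      gcongr
      refine (hpt _ _ _).trans (pow_le_pow_left₀ (by positivity) ?_ _)
      have h1 : ‖A j‖ ≤ (Fintype.card p + 1) * ‖X v‖ * D :=
        (norm_matrix_mul_le _ _).trans (by have := hYD j; gcongr)
      have h2 : ((Fintype.card m : ℝ) + 1) ^ 2 * ‖A j‖ ≤
        (Fintype.card m + 1) ^ 2 * ((Fintype.card p + 1) * ‖X v‖ * D) := by gcongr
      linarith
    have hint : ∀ j, MeasureTheory.Integrable (fun ω => c j * (κ ω * A j).trace ^ d j) μ :=
      fun j => (MeasureTheory.integrable_const _).mono' ((hms _ _).const_mul _)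
        (Filter.Eventually.of_forall (hbd j))
    have key := MeasureTheory.hasSum_integral_of_summable_integral_norm hint
      ((hsum S hS0).of_nonneg_of_le (fun j => MeasureTheory.integral_nonneg fun _ => norm_nonneg _)
        fun j => ?_)
    · simp only [hω, MeasureTheory.integral_const_mul] at key
      rw [key.tsum_eq]
      simp
    · have := MeasureTheory.integral_mono (hint j).norm
        (MeasureTheory.integrable_const (‖c j‖ * S ^ d j)) (hbd j)
      simpa using this
end

/-! ### Linear forms as matrices, and real structures from unitary Gram matrices -/

/-- The matrix of coefficients of a linear form, transported along `π`, dual to matrix entries. -/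
def dualCoeff {m q : Type} [DecidableEq m] [DecidableEq q] {V : Type*} [AddCommGroup V]
    [Module ℂ V] (π : Matrix m q ℂ →ₗ[ℂ] V) : (V →ₗ[ℂ] ℂ) →ₗ[ℂ] Matrix q m ℂ where
  toFun l := Matrix.of fun j i => l (π (Matrix.single i j 1))
  map_add' _ _ := rfl
  map_smul' _ _ := rfl

theorem apply_eq_trace_mul_dualCoeff {m q : Type} [Fintype m] [Fintype q] [DecidableEq m]
    [DecidableEq q] {V : Type*} [AddCommGroup V] [Module ℂ V] (π : Matrix m q ℂ →ₗ[ℂ] V)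
    (l : V →ₗ[ℂ] ℂ) (Z : Matrix m q ℂ) : l (π Z) = (Z * dualCoeff π l).trace := by
  conv_lhs => rw [matrix_eq_sum_single Z]
  simp only [map_sum, Matrix.trace, Matrix.diag, Matrix.mul_apply]
  refine Finset.sum_congr rfl fun i _ => Finset.sum_congr rfl fun j _ => ?_
  have : Matrix.single i j (Z i j) = Z i j • Matrix.single i j (1 : ℂ) := by
    rw [Matrix.smul_single, smul_eq_mul, mul_one]
  rw [this, map_smul, map_smul]
  rfl

theorem map_star_smul {m : Type} (c : ℂ) (A : Matrix m m ℂ) : (c • A).map star = star c • A.map star := by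
  ext i j
  simp

theorem map_star_mul {m : Type} [Fintype m] (A B : Matrix m m ℂ) : (A * B).map star = A.map star * B.map star :=
  Matrix.map_mul (f := starRingEnd ℂ)

theorem conjTranspose_eq_smul_map_star {m : Type} {β : Matrix m m ℂ} {ε : ℝ} (hβ : βᵀ = (ε : ℂ) • β) :
    βᴴ = (ε : ℂ) • β.map star := by
  ext i j
  have := congrFun (congrFun hβ i) j
  simp only [transpose_apply, Matrix.smul_apply, smul_eq_mul] at this
  simp [this]

section
variable {m : Type} [Fintype m] [DecidableEq m]

theorem aeval_transpose_mul_of_comm {P β : Matrix m m ℂ} (h : Pᵀ * β = β * P)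
    (q : Polynomial ℝ) : (Polynomial.aeval P q)ᵀ * β = β * Polynomial.aeval P q := by
  have hpow : ∀ n : ℕ, (P ^ n)ᵀ * β = β * P ^ n := by
    intro n
    induction n with
    | zero => simp
    | succ n ih =>
      rw [pow_succ', transpose_mul, Matrix.mul_assoc, h, ← Matrix.mul_assoc, ih,
        Matrix.mul_assoc, ← pow_succ, pow_succ']
  induction q using Polynomial.induction_on' with
  | add p q hp hq => simp only [map_add, transpose_add, Matrix.add_mul, Matrix.mul_add, hp, hq]
  | monomial n a =>
    rw [Polynomial.aeval_monomial, ← Algebra.smul_def, transpose_smul, Matrix.smul_mul, hpow,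
      Matrix.mul_smul]

open scoped ComplexOrder in
/-- A nondegenerate symmetric or alternating Gram matrix becomes unitary in a suitable basis. -/
theorem exists_congruent_unitary {β : Matrix m m ℂ} {ε : ℝ}
    (hβ : βᵀ = (ε : ℂ) • β) (hdet : IsUnit β.det) :
    ∃ g : Matrix m m ℂ, IsUnit g.det ∧ (gᵀ * β * g)ᴴ * (gᵀ * β * g) = 1 := by
  have hpos : (βᴴ * β).PosDef := Matrix.PosDef.conjTranspose_mul_self β
    (Matrix.mulVec_injective_of_isUnit ((Matrix.isUnit_iff_isUnit_det β).2 hdet))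
  have hH := hpos.1
  set P := βᴴ * β with hP
  -- `g = P^{-1/4}`: since `gᵗ β g = β g²`, unitarity amounts to `g² P g² = 1`.
  obtain ⟨q, hq⟩ := exists_aeval_eq_conj_diagonal hH fun x => (√(√x))⁻¹
  set Φ := Unitary.conjStarAlgAut ℂ (Matrix m m ℂ) hH.eigenvectorUnitary with hΦ
  set g := Polynomial.aeval P q with hg
  have hcomm : Pᵀ * β = β * P := by
    have h1 : (βᴴ)ᵀ = β.map star := by
      ext i j
      simp
    rw [hP, transpose_mul, hβ, h1, conjTranspose_eq_smul_map_star hβ]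
    simp [Matrix.mul_assoc]
  have hgt : gᵀ * β = β * g := aeval_transpose_mul_of_comm hcomm q
  have hgH : gᴴ = g := by
    rw [hq]
    change star (Φ _) = _
    rw [← map_star, star_eq_conjTranspose, diagonal_conjTranspose]
    congr 2
    funext i
    simp
  have hgP : g * g * P * g * g = 1 := by
    have hPd : P = Φ (diagonal fun i => (hH.eigenvalues i : ℂ)) := hH.spectral_theorem
    have h1 : g * g * P * g * g = g * g * Φ (diagonal fun i => (hH.eigenvalues i : ℂ)) * g * g := by
      rw [← hPd]
    rw [h1, hq, ← map_mul, ← map_mul, ← map_mul, ← map_mul]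
    simp only [diagonal_mul_diagonal]
    rw [← map_one Φ, ← diagonal_one]
    congr 2
    funext i
    have hl := hpos.eigenvalues_pos i
    have hs : √(√(hH.eigenvalues i)) ≠ 0 := (Real.sqrt_pos.2 (Real.sqrt_pos.2 hl)).ne'
    have h4 : hH.eigenvalues i = √(√(hH.eigenvalues i)) ^ 4 := by
      rw [show 4 = 2 * 2 from rfl, pow_mul, Real.sq_sqrt (Real.sqrt_nonneg _), Real.sq_sqrt hl.le]
    have h5 : (√(√(hH.eigenvalues i)))⁻¹ * (√(√(hH.eigenvalues i)))⁻¹ * hH.eigenvalues i *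
        (√(√(hH.eigenvalues i)))⁻¹ * (√(√(hH.eigenvalues i)))⁻¹ = 1 := by
      generalize √(√(hH.eigenvalues i)) = x at hs h4 ⊢
      rw [h4]
      field_simp
    exact_mod_cast h5
  refine ⟨g, Matrix.isUnit_det_of_left_inverse hgP, ?_⟩
  rw [hgt, conjTranspose_mul, conjTranspose_mul, hgH, ← hgP, hP]
  simp only [Matrix.mul_assoc]

/-- The real `*`-algebra of matrices commuting with the (real or quaternionic) structure
`v ↦ β⁻¹ v̄` attached to a unitary Gram matrix `β`. -/
def realStructureAlgebra (β : Matrix m m ℂ) : Subalgebra ℝ (Matrix m m ℂ) where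
  carrier := {A | β * A = A.map star * β}
  mul_mem' := by
    intro a b ha hb
    simp only [Set.mem_ofPred_eq] at *
    rw [map_star_mul, ← Matrix.mul_assoc, ha, Matrix.mul_assoc, hb, Matrix.mul_assoc]
  add_mem' := by
    intro a b ha hb
    simp only [Set.mem_ofPred_eq] at *
    rw [Matrix.map_add _ star_add, Matrix.mul_add, Matrix.add_mul, ha, hb]
  algebraMap_mem' := by
    intro r
    simp only [Set.mem_ofPred_eq]
    rw [Algebra.algebraMap_eq_smul_one]
    have : (r • (1 : Matrix m m ℂ)).map star = r • 1 := by
      ext i j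
      simp [Matrix.one_apply]
      split_ifs <;> simp
    rw [this]
    simp

theorem mem_realStructureAlgebra {β A : Matrix m m ℂ} :
    A ∈ realStructureAlgebra β ↔ β * A = A.map star * β := Iff.rfl

/-- Conjugate transpose on `R` is the adjoint for the bilinear form `β`; consequently the unitary
elements of `R` are isometries of `β`. -/
theorem realStructureAlgebra_transpose_mul {β A : Matrix m m ℂ} (hu : βᴴ * β = 1)
    (hA : A ∈ realStructureAlgebra β) : β * Aᴴ = Aᵀ * β := by
  have hu' : β * βᴴ = 1 := mul_eq_one_comm.1 hu
  have h1 := congrArg conjTranspose (mem_realStructureAlgebra.1 hA)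
  rw [conjTranspose_mul, conjTranspose_mul] at h1
  have h2 : (A.map star)ᴴ = Aᵀ := by
    ext i j
    simp
  rw [h2] at h1
  calc β * Aᴴ = β * (Aᴴ * βᴴ) * β := by
        rw [Matrix.mul_assoc, Matrix.mul_assoc, hu, Matrix.mul_one]
    _ = Aᵀ * β := by rw [h1, ← Matrix.mul_assoc, hu', Matrix.one_mul]

theorem conjTranspose_mem_realStructureAlgebra {β A : Matrix m m ℂ} (hu : βᴴ * β = 1)
    (hA : A ∈ realStructureAlgebra β) : Aᴴ ∈ realStructureAlgebra β := by
  rw [mem_realStructureAlgebra, realStructureAlgebra_transpose_mul hu hA]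
  congr 1
  ext i j
  simp

/-- `A ↦ β* Ā β` is an antilinear map, an involution because `ε² = 1`, with fixed set `R`. The two
terms are the real and imaginary parts for it. -/
theorem exists_real_add_imaginary {β : Matrix m m ℂ} {ε : ℝ} (hε : ε * ε = 1)
    (hβ : βᵀ = (ε : ℂ) • β) (hu : βᴴ * β = 1) (A : Matrix m m ℂ) :
    ∃ a ∈ realStructureAlgebra β, ∃ b ∈ realStructureAlgebra β, A = a + Complex.I • b := by
  have hu' : β * βᴴ = 1 := mul_eq_one_comm.1 hu
  set B := βᴴ * A.map star * β with hB
  have h1 : β * B = A.map star * β := by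
    rw [hB, ← Matrix.mul_assoc, ← Matrix.mul_assoc, hu', Matrix.one_mul]
  have hε' : (ε : ℂ) * ε = 1 := by exact_mod_cast hε
  have h2 : B.map star * β = β * A := by
    have h3 : (βᴴ).map star = (ε : ℂ) • β := by
      rw [← hβ]
      ext i j
      simp
    have h4 : β.map star = (ε : ℂ) • βᴴ := by
      rw [conjTranspose_eq_smul_map_star hβ, smul_smul, hε', one_smul]
    have h5 : (A.map star).map star = A := by
      ext i j
      simp
    rw [hB, map_star_mul, map_star_mul, h3, h4, h5]
    simp only [Matrix.smul_mul, Matrix.mul_smul, smul_smul, hε', one_smul, Matrix.mul_assoc, hu,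
      Matrix.mul_one]
  refine ⟨(1 / 2 : ℂ) • (A + B), ?_, (-Complex.I / 2) • (A - B), ?_, ?_⟩
  · rw [mem_realStructureAlgebra, map_star_smul, Matrix.map_add _ star_add, Matrix.mul_smul,
      Matrix.smul_mul, Matrix.mul_add, Matrix.add_mul, h1, h2, add_comm (β * A)]
    simp
  · rw [mem_realStructureAlgebra, map_star_smul, Matrix.map_sub _ star_sub, Matrix.mul_smul,
      Matrix.smul_mul, Matrix.mul_sub, Matrix.sub_mul, h1, h2, ← neg_sub (β * A), smul_neg,
      ← neg_smul]
    congr 1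
    simp [neg_div]
  · rw [smul_smul]
    have : Complex.I * (-Complex.I / 2) = 1 / 2 := by
      rw [mul_div_assoc', mul_neg, Complex.I_mul_I, neg_neg]
    rw [this, ← smul_add]
    module
end

/-! ### The orthogonal and symplectic cases -/

section
variable {n p : ℕ}

/-- `V` as a space of `n × 2p` matrices, in a basis of `ℂⁿ` given by `g` (with inverse `g'`); `β'`
is the inverse of the Gram matrix `β`. -/
def columnsMap (p : ℕ) (g' β' : Matrix (Fin n) (Fin n) ℂ) :
    VSpace n p →ₗ[ℂ] Matrix (Fin n) (Fin p ⊕ Fin p) ℂ where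
  toFun v := g' * fromCols (β' * v.1ᵀ) v.2
  map_add' v w := by
    rw [← Matrix.mul_add]
    congr 1
    ext i (j | j) <;> simp [Matrix.mul_add]
  map_smul' c v := by
    rw [RingHom.id_apply, ← Matrix.mul_smul]
    congr 1
    ext i (j | j) <;> simp

/-- The inverse of `columnsMap`. -/
def columnsInv (p : ℕ) (g β : Matrix (Fin n) (Fin n) ℂ) :
    Matrix (Fin n) (Fin p ⊕ Fin p) ℂ →ₗ[ℂ] VSpace n p where
  toFun Z := ((β * (g * Z).toCols₁)ᵀ, (g * Z).toCols₂)
  map_add' v w := by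
    refine Prod.ext ?_ ?_
    · rw [Prod.fst_add, ← transpose_add, ← Matrix.mul_add, Matrix.mul_add g]
      rfl
    · rw [Matrix.mul_add]
      rfl
  map_smul' c v := by
    refine Prod.ext ?_ ?_
    · rw [RingHom.id_apply, Prod.smul_fst, ← transpose_smul, ← Matrix.mul_smul, Matrix.mul_smul g]
      rfl
    · rw [Matrix.mul_smul]
      rfl

theorem columnsInv_columnsMap {g g' β β' : Matrix (Fin n) (Fin n) ℂ} (hg : g * g' = 1)
    (hβ : β * β' = 1) (v : VSpace n p) : columnsInv p g β (columnsMap p g' β' v) = v := by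
  change ((β * (g * (g' * fromCols (β' * v.1ᵀ) v.2)).toCols₁)ᵀ,
    (g * (g' * fromCols (β' * v.1ᵀ) v.2)).toCols₂) = v
  rw [← Matrix.mul_assoc, hg, Matrix.one_mul, toCols₁_fromCols, toCols₂_fromCols,
    ← Matrix.mul_assoc, hβ, Matrix.one_mul, transpose_transpose]

/-- The linear change of variables from the Gram matrix to `QMat`. -/
def gramOfQMat (p : ℕ) (ε : ℂ) (w : Matrix (Fin p ⊕ Fin p) (Fin p ⊕ Fin p) ℂ) :
    Matrix (Fin p ⊕ Fin p) (Fin p ⊕ Fin p) ℂ :=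
  fromBlocks (ε • w.toBlocks₁₂) (ε • w.toBlocks₁₁) w.toBlocks₂₂ w.toBlocks₂₁

theorem differentiable_gramOfQMat (ε : ℂ) : Differentiable ℂ (gramOfQMat p ε) := by
  have h : ∀ i j, Differentiable ℂ
      fun w : Matrix (Fin p ⊕ Fin p) (Fin p ⊕ Fin p) ℂ => w i j :=
    differentiable_matrix_iff.1 differentiable_id
  refine differentiable_matrix_iff.2 ?_
  rintro (i | i) (j | j)
  · exact (h _ _).const_mul ε
  · exact (h _ _).const_mul ε
  · exact h _ _
  · exact h _ _

/-- In the columns `Z = (β⁻¹Lᵗ | L̃)`, the blocks of `Zᵗ β Z` are those of `Q` in another order; `ε`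
enters through `(β⁻¹)ᵗ = ε β⁻¹`. -/
theorem gram_columnsMap {β g g' : Matrix (Fin n) (Fin n) ℂ} {ε : ℝ} (hε : ε * ε = 1)
    (hβ : βᵀ = (ε : ℂ) • β) (hdet : IsUnit β.det) (hg : g * g' = 1) (v : VSpace n p) :
    (columnsMap p g' β⁻¹ v)ᵀ * (gᵀ * β * g) * columnsMap p g' β⁻¹ v =
      gramOfQMat p ε (QMat β v) := by
  have hε' : (ε : ℂ) * ε = 1 := by exact_mod_cast hε
  have hi : β⁻¹ᵀ = (ε : ℂ) • β⁻¹ := by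
    rw [transpose_nonsing_inv, hβ]
    refine inv_eq_left_inv ?_
    rw [Matrix.smul_mul, Matrix.mul_smul, smul_smul, hε', one_smul, nonsing_inv_mul _ hdet]
  have h1 : g'ᵀ * gᵀ = 1 := by rw [← transpose_mul, hg, transpose_one]
  change (g' * fromCols (β⁻¹ * v.1ᵀ) v.2)ᵀ * (gᵀ * β * g) * (g' * fromCols (β⁻¹ * v.1ᵀ) v.2) = _
  set Z := fromCols (β⁻¹ * v.1ᵀ) v.2 with hZ
  have h2 : (g' * Z)ᵀ * (gᵀ * β * g) * (g' * Z) = Zᵀ * β * Z := by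
    calc _ = Zᵀ * (g'ᵀ * gᵀ) * β * (g * g') * Z := by
          rw [transpose_mul]
          simp only [Matrix.mul_assoc]
      _ = _ := by rw [h1, hg, Matrix.mul_one, Matrix.mul_one]
  rw [h2, hZ, transpose_fromCols, Matrix.mul_assoc, mul_fromCols, fromRows_mul_fromCols]
  have h3 : β * (β⁻¹ * v.1ᵀ) = v.1ᵀ := mul_nonsing_inv_cancel_left _ _ hdet
  rw [h3, transpose_mul, transpose_transpose, hi]
  simp only [gramOfQMat, QMat, toBlocks_fromBlocks₁₁, toBlocks_fromBlocks₁₂,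
    toBlocks_fromBlocks₂₁, toBlocks_fromBlocks₂₂, Matrix.mul_assoc, Matrix.smul_mul,
    Matrix.mul_smul]
  rw [nonsing_inv_mul_cancel_left _ _ hdet]

/-- A holomorphic function on `V` invariant under the isometry group of a nondegenerate symmetric
or alternating form is a holomorphic function of `QMat`. -/
theorem exists_differentiable_QMat {β : Matrix (Fin n) (Fin n) ℂ} {ε : ℝ} (hε : ε * ε = 1)
    (hβ : βᵀ = (ε : ℂ) • β) (hdet : IsUnit β.det) (f : HolInv (isomGroup β) p) :
    ∃ F : Matrix (Fin p ⊕ Fin p) (Fin p ⊕ Fin p) ℂ → ℂ, Differentiable ℂ F ∧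
      ∀ v, F (QMat β v) = (f : VSpace n p → ℂ) v := by
  obtain ⟨g, hgdet, hu⟩ := exists_congruent_unitary hβ hdet
  set β₁ := gᵀ * β * g with hβ₁
  have hg1 : g * g⁻¹ = 1 := mul_nonsing_inv _ hgdet
  have hg2 : g⁻¹ * g = 1 := nonsing_inv_mul _ hgdet
  have hβ₁t : β₁ᵀ = (ε : ℂ) • β₁ := by
    rw [hβ₁, transpose_mul, transpose_mul, transpose_transpose, hβ]
    simp [Matrix.mul_assoc]
  have hβ₁k : ∀ k ∈ realStructureAlgebra β₁, kᴴ * k = 1 → kᵀ * β₁ * k = β₁ := by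
    intro k hk hkk
    rw [← realStructureAlgebra_transpose_mul hu hk, Matrix.mul_assoc, hkk, Matrix.mul_one]
  obtain ⟨F, hF, hFf⟩ := exists_differentiable_gram f.2.1
    (R := realStructureAlgebra β₁) (fun A hA => conjTranspose_mem_realStructureAlgebra hu hA)
    (β := β₁) (β' := β₁ᴴ) (fun A hA => by
      rw [Matrix.mul_assoc, ← realStructureAlgebra_transpose_mul hu hA, ← Matrix.mul_assoc, hu,
        Matrix.one_mul])
    (columnsMap p g⁻¹ β⁻¹) (dualCoeff (columnsInv p g β))
    (fun v l => by
      rw [← apply_eq_trace_mul_dualCoeff,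
        columnsInv_columnsMap hg1 (mul_nonsing_inv _ hdet)])
    (fun v l => exists_real_add_imaginary hε hβ₁t hu _)
    (fun k hk hkk v => by
      have hkk' : k * kᴴ = 1 := mul_eq_one_comm.1 hkk
      -- The element `k` written in the original basis, where it preserves `β`.
      let γ : GL (Fin n) ℂ := ⟨g * k * g⁻¹, g * kᴴ * g⁻¹, by
          calc _ = g * (k * (g⁻¹ * g) * kᴴ) * g⁻¹ := by simp only [Matrix.mul_assoc]
            _ = 1 := by rw [hg2, Matrix.mul_one, hkk', Matrix.mul_one, hg1], by
          calc _ = g * (kᴴ * (g⁻¹ * g) * k) * g⁻¹ := by simp only [Matrix.mul_assoc]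
            _ = 1 := by rw [hg2, Matrix.mul_one, hkk, Matrix.mul_one, hg1]⟩
      have hgt : (g⁻¹)ᵀ * gᵀ = 1 := by rw [← transpose_mul, hg1, transpose_one]
      have hγ : (g * k * g⁻¹)ᵀ * β * (g * k * g⁻¹) = β := by
        calc _ = (g⁻¹)ᵀ * (kᵀ * β₁ * k) * g⁻¹ := by
              simp only [hβ₁, transpose_mul, Matrix.mul_assoc]
          _ = ((g⁻¹)ᵀ * gᵀ) * β * (g * g⁻¹) := by
              rw [hβ₁k k hk hkk]
              simp only [hβ₁, Matrix.mul_assoc]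
          _ = β := by rw [hgt, hg1, Matrix.one_mul, Matrix.mul_one]
      refine ⟨gact γ v, ?_, f.2.2 γ hγ v⟩
      -- For an isometry, `β⁻¹ γ⁻ᵗ = γ β⁻¹`, so `β⁻¹ Lᵗ` and `L̃` transform in the same way.
      have h1 : β⁻¹ * (g * kᴴ * g⁻¹)ᵀ = g * k * g⁻¹ * β⁻¹ := by
        have h2 : (g * k * g⁻¹) * (g * kᴴ * g⁻¹) = 1 := γ.val_inv
        have h3 : (g * kᴴ * g⁻¹)ᵀ * (g * k * g⁻¹)ᵀ = 1 := by
          rw [← transpose_mul, h2, transpose_one]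
        calc _ = β⁻¹ * (g * kᴴ * g⁻¹)ᵀ * (β * β⁻¹) := by
              rw [mul_nonsing_inv _ hdet, Matrix.mul_one]
          _ = β⁻¹ * (g * kᴴ * g⁻¹)ᵀ * ((g * k * g⁻¹)ᵀ * β * (g * k * g⁻¹) * β⁻¹) := by rw [hγ]
          _ = β⁻¹ * ((g * kᴴ * g⁻¹)ᵀ * (g * k * g⁻¹)ᵀ) * β * (g * k * g⁻¹) * β⁻¹ := by
              simp only [Matrix.mul_assoc]
          _ = _ := by
              rw [h3, Matrix.mul_one, nonsing_inv_mul _ hdet, Matrix.one_mul]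
      change g⁻¹ * fromCols (β⁻¹ * (v.1 * (g * kᴴ * g⁻¹))ᵀ) (g * k * g⁻¹ * v.2) =
        k * (g⁻¹ * fromCols (β⁻¹ * v.1ᵀ) v.2)
      rw [transpose_mul, ← Matrix.mul_assoc β⁻¹, h1, Matrix.mul_assoc _ β⁻¹, ← mul_fromCols]
      simp only [← Matrix.mul_assoc]
      rw [hg2, Matrix.one_mul])
  refine ⟨fun w => F (gramOfQMat p ε w), hF.comp (differentiable_gramOfQMat _), fun v => ?_⟩
  rw [← hFf v, gram_columnsMap hε hβ hdet hg1]

/-! ### The general linear case -/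

/-- `V` as a space of block diagonal matrices. -/
def blockMap (n p : ℕ) : VSpace n p →ₗ[ℂ] Matrix (Fin n ⊕ Fin n) (Fin p ⊕ Fin p) ℂ where
  toFun v := fromBlocks v.1ᵀ 0 0 v.2
  map_add' v w := by simp [fromBlocks_add]
  map_smul' c v := by simp [fromBlocks_smul]

/-- A left inverse of `blockMap`. -/
def blockInv (n p : ℕ) : Matrix (Fin n ⊕ Fin n) (Fin p ⊕ Fin p) ℂ →ₗ[ℂ] VSpace n p where
  toFun Z := (Z.toBlocks₁₁ᵀ, Z.toBlocks₂₂)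
  map_add' _ _ := rfl
  map_smul' _ _ := rfl

/-- The real `*`-algebra of block matrices `diag(Ā, A)`. -/
def conjPairAlgebra (n : ℕ) : Subalgebra ℝ (Matrix (Fin n ⊕ Fin n) (Fin n ⊕ Fin n) ℂ) where
  carrier := {M | ∃ A, M = fromBlocks (A.map star) 0 0 A}
  mul_mem' := by
    rintro _ _ ⟨A, rfl⟩ ⟨B, rfl⟩
    exact ⟨A * B, by rw [fromBlocks_multiply, map_star_mul]; simp⟩
  add_mem' := by
    rintro _ _ ⟨A, rfl⟩ ⟨B, rfl⟩
    exact ⟨A + B, by rw [fromBlocks_add, Matrix.map_add _ star_add]; simp⟩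
  algebraMap_mem' := by
    intro r
    refine ⟨(r : ℂ) • 1, ?_⟩
    rw [map_star_smul, Algebra.algebraMap_eq_smul_one]
    have : (1 : Matrix (Fin n) (Fin n) ℂ).map star = 1 := by
      ext i j
      by_cases h : i = j <;> simp [Matrix.one_apply, h]
    rw [this, ← fromBlocks_one, fromBlocks_smul]
    simp

theorem dualCoeff_blockInv (l : VSpace n p →ₗ[ℂ] ℂ) : ∃ B C,
    dualCoeff (blockInv n p) l = fromBlocks B 0 0 C := by
  refine ⟨(dualCoeff (blockInv n p) l).toBlocks₁₁, (dualCoeff (blockInv n p) l).toBlocks₂₂, ?_⟩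
  conv_lhs => rw [← fromBlocks_toBlocks (dualCoeff (blockInv n p) l)]
  congr 1
  · ext i j
    have : blockInv n p (Matrix.single (Sum.inr j) (Sum.inl i) 1) = 0 := by
      refine Prod.ext ?_ ?_ <;> ext a b
      · change (Matrix.single (Sum.inr j) (Sum.inl i) 1 : Matrix (Fin n ⊕ Fin n) (Fin p ⊕ Fin p) ℂ)
          (Sum.inl b) (Sum.inl a) = 0
        simp
      · change (Matrix.single (Sum.inr j) (Sum.inl i) 1 : Matrix (Fin n ⊕ Fin n) (Fin p ⊕ Fin p) ℂ)
          (Sum.inr a) (Sum.inr b) = 0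
        simp
    change l _ = 0
    rw [this, map_zero]
  · ext i j
    have : blockInv n p (Matrix.single (Sum.inl j) (Sum.inr i) 1) = 0 := by
      refine Prod.ext ?_ ?_ <;> ext a b
      · change (Matrix.single (Sum.inl j) (Sum.inr i) 1 : Matrix (Fin n ⊕ Fin n) (Fin p ⊕ Fin p) ℂ)
          (Sum.inl b) (Sum.inl a) = 0
        simp
      · change (Matrix.single (Sum.inl j) (Sum.inr i) 1 : Matrix (Fin n ⊕ Fin n) (Fin p ⊕ Fin p) ℂ)
          (Sum.inr a) (Sum.inr b) = 0
        simp
    change l _ = 0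
    rw [this, map_zero]

/-- The complexification of `{diag(Ā, A)}` is all of the block diagonal matrices: `C = a + ib` and
`B = ā + i b̄` are solved by `a = (C + B̄)/2`, `b = (C - B̄)/(2i)`. -/
theorem fromBlocks_mem_conjPair_add (B C : Matrix (Fin n) (Fin n) ℂ) :
    ∃ a ∈ conjPairAlgebra n, ∃ b ∈ conjPairAlgebra n,
      fromBlocks B 0 0 C = a + Complex.I • b := by
  refine ⟨_, ⟨(1 / 2 : ℂ) • (C + B.map star), rfl⟩, _,
    ⟨(-Complex.I / 2) • (C - B.map star), rfl⟩, ?_⟩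
  have h5 : (B.map star).map star = B := by
    ext i j
    simp
  have h1 : Complex.I * (-Complex.I / 2) = 1 / 2 := by
    rw [mul_div_assoc', mul_neg, Complex.I_mul_I, neg_neg]
  have h2 : Complex.I * (Complex.I / 2) = -(1 / 2) := by
    rw [mul_div_assoc', Complex.I_mul_I, neg_div]
  rw [fromBlocks_smul, fromBlocks_add]
  simp only [map_star_smul, Matrix.map_add _ star_add, Matrix.map_sub _ star_sub, h5, smul_smul]
  congr 1
  · have : star (-Complex.I / 2) = Complex.I / 2 := by simp
    rw [this, h2]
    have : star (1 / 2 : ℂ) = 1 / 2 := by simp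
    rw [this]
    module
  · simp
  · simp
  · rw [h1]
    module

/-- A `GL_n`-invariant holomorphic function on `V` is a holomorphic function of `L L̃`. -/
theorem exists_differentiable_QGL (f : HolInv (⊤ : Subgroup (GL (Fin n) ℂ)) p) :
    ∃ F : Matrix (Fin p) (Fin p) ℂ → ℂ, Differentiable ℂ F ∧
      ∀ v, F (QGL v) = (f : VSpace n p → ℂ) v := by
  obtain ⟨F, hF, hFf⟩ := exists_differentiable_gram f.2.1
    (R := conjPairAlgebra n) (by
      rintro _ ⟨A, rfl⟩
      refine ⟨Aᴴ, ?_⟩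
      rw [fromBlocks_conjTranspose]
      simp
      rfl)
    -- The form pairing the two copies of `ℂⁿ`: swapping the blocks of the transpose `diag(A*, Aᵗ)`
    -- gives the conjugate transpose `diag(Aᵗ, A*)`.
    (β := fromBlocks 0 1 1 0) (β' := fromBlocks 0 1 1 0) (by
      rintro _ ⟨A, rfl⟩
      rw [fromBlocks_conjTranspose, fromBlocks_transpose, fromBlocks_multiply, fromBlocks_multiply]
      simp only [Matrix.zero_mul, Matrix.mul_zero, Matrix.one_mul, Matrix.mul_one, zero_add,
        add_zero, transpose_zero, conjTranspose_zero]
      congr 1 <;> (ext i j; simp))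
    (blockMap n p) (dualCoeff (blockInv n p))
    (fun v l => by
      rw [← apply_eq_trace_mul_dualCoeff]
      rfl)
    (fun v l => by
      obtain ⟨B, C, hBC⟩ := dualCoeff_blockInv l
      have : blockMap n p v * dualCoeff (blockInv n p) l =
          fromBlocks (v.1ᵀ * B) 0 0 (v.2 * C) := by
        have hb : blockMap n p v = fromBlocks v.1ᵀ 0 0 v.2 := rfl
        rw [hBC, hb, fromBlocks_multiply]
        simp
      rw [this]
      exact fromBlocks_mem_conjPair_add _ _)
    (by
      rintro _ ⟨A, rfl⟩ hk v
      have hA : Aᴴ * A = 1 := by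
        rw [fromBlocks_conjTranspose, fromBlocks_multiply, ← fromBlocks_one] at hk
        simpa using (fromBlocks_inj.1 hk).2.2.2
      let γ : GL (Fin n) ℂ := ⟨A, Aᴴ, mul_eq_one_comm.1 hA, hA⟩
      refine ⟨gact γ v, ?_, f.2.2 γ trivial v⟩
      change fromBlocks (v.1 * Aᴴ)ᵀ 0 0 (A * v.2) = _ * fromBlocks v.1ᵀ 0 0 v.2
      rw [fromBlocks_multiply, transpose_mul]
      have : Aᴴᵀ = A.map star := by
        ext i j
        simp
      rw [this]
      simp)
  -- The Gram matrix of `diag(Lᵗ, L̃)` for the swap form has off-diagonal blocks `L L̃` and its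
  -- transpose, and zero diagonal blocks.
  refine ⟨fun w => F (fromBlocks 0 w wᵀ 0), hF.comp ?_, fun v => ?_⟩
  · have h : ∀ i j, Differentiable ℂ fun w : Matrix (Fin p) (Fin p) ℂ => w i j :=
      differentiable_matrix_iff.1 differentiable_id
    refine differentiable_matrix_iff.2 ?_
    rintro (i | i) (j | j)
    · exact differentiable_const _
    · exact h _ _
    · exact h _ _
    · exact differentiable_const _
  · rw [← hFf v]
    change _ = F ((fromBlocks v.1ᵀ 0 0 v.2)ᵀ * _ * fromBlocks v.1ᵀ 0 0 v.2)
    rw [fromBlocks_transpose, fromBlocks_multiply, fromBlocks_multiply]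
    simp [QGL]
end

/-! ### Surjectivity in the three cases -/

theorem mainTheorem8 (n p : ℕ) :
    Function.Surjective (QstarGL n p) ∧
    (∀ (β : Matrix (Fin n) (Fin n) ℂ) (hs : βᵀ = β), IsUnit β.det →
      Function.Surjective (QstarO p β hs)) ∧
    (∀ (β : Matrix (Fin n) (Fin n) ℂ) (ha : βᵀ = -β) (hβ : IsUnit β.det),
      Function.Surjective (QstarSp p β ha hβ)) := by
  refine ⟨fun f => ?_, fun β hs hβ f => ?_, fun β ha hβ f => ?_⟩
  · obtain ⟨F, hF, hFf⟩ := exists_differentiable_QGL f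
    exact ⟨⟨F, hF⟩, Subtype.ext (funext hFf)⟩
  · obtain ⟨F, hF, hFf⟩ := exists_differentiable_QMat (ε := 1) (by norm_num) (by simpa using hs)
      hβ f
    exact ⟨⟨fun w => F w, hF.comp (SymB (formS p)).subtypeL.differentiable⟩,
      Subtype.ext (funext hFf)⟩
  · obtain ⟨F, hF, hFf⟩ := exists_differentiable_QMat (ε := -1) (by norm_num) (by simpa using ha)
      hβ f
    exact ⟨⟨fun w => F w, hF.comp (SymB (formA p)).subtypeL.differentiable⟩,
      Subtype.ext (funext hFf)⟩
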